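/- Fields are functions $f:\mathbb R^2\to\mathbb C$. For $f\in L^2(\mathbb R^2)$ let $F(\omega)=\int_{\mathbb R^2} f(r)\,e^{-\mathrm i\langle\omega,r\rangle}\,dr$ (in the $L^2$ sense) be its Fourier transform, and for $\Omega\subset\mathbb R^2$ let $\mathcal B_\Omega=\{f\in L^2(\mathbb R^2): F(\omega)=0\text{ for a.e. }\omega\notin\Omega\}$; for bounded $\Omega$ the elements of $\mathcal B_\Omega$ are identified with their continuous representatives. For $s\in\mathbb R^2$ write $\Omega(s)=\{x: x-s\in\Omega\}$, and let $\mathring\Omega$ be the interior of $\Omega$. A trajectory set is a countable collection $P=\{p_i\}$ of continuous maps $p_i:\mathbb R\to\mathbb R^2$. For $a>0$ and $x\in\mathbb R^2$ let $\mathcal D^P(a,x)$ be the total arc length of the trajectories of $P$ inside the closed disc $B_a(x)$ of radius $a$ about $x$, i.e. $\mathcal D^P(a,x)=\sum_i\int_{\{t:\|p_i(t)-x\|\le a\}}\|p_i'(t)\|\,dt$ when the $p_i$ are smooth. $P$ is called a Nyquist trajectory set for $\Omega$ if 1. (Nyquist) there is a set $\Lambda\subset\bigcup_i p_i(\mathbb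 R)$ that is uniformly discrete (for some $r>0$ any two distinct points of $\Lambda$ are more than $r$ apart) and such that any $f\in\mathcal B_\Omega$ is uniquely determined by its values on $\Lambda$; and 2. (Non-degeneracy) for every $x\in\mathbb R^2$, the part of $\bigcup_i p_i(\mathbb R)$ in $B_a(x)$ is contained in a continuous curve of length at most $\mathcal D^P(a,x)+o(a^2)$ as $a\to\infty$. **Theorem 1.** Let $\Omega\subset\mathbb R^2$ be a compact convex set. Let $N=1$ or $N=2$ and let $P=\bigcup_{i=1}^N P_i$, where $P_i=\{p_{i,j}: j\in\mathbb Z\}$ is the uniform set of lines $$p_{i,j}(t)=w_i+j\,\Delta_i\,v_i^\perp+t\,v_i,\qquad t\in\mathbb R,$$ with $w_i\in\mathbb R^2$, $0\ne v_i\in\mathbb R^2$, $\Delta_i>0$ and $v_i^\perp$ a unit vector orthogonal to $v_i$. For $N=2$ assume that $v_1$ and $v_2$ are non-collinear. Put $u_i=\frac{2\pi v_i^\perp}{\Delta_i}$ and $$\mathcal Q=\Big\{\sum_{i=1}^N(-1)^{k_i}\frac{u_i}{2}: k_i\in\{0,1\},\ 1\le i\le N\Big\}.$$ Then $P$ is a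 Nyquist trajectory set for $\Omega$ if $\mathcal Q\nsubseteq\Omega(s)$ for all $s\in\mathbb R^2$, and $P$ is not a Nyquist trajectory set for $\Omega$ if $\mathcal Q\subset\mathring\Omega(s)$ for some $s\in\mathbb R^2$. -/

import Mathlib

open MeasureTheory Set Filter Asymptotics
open scoped ENNReal FourierTransform

noncomputable section

/-- The Euclidean space `ℝ^d`. -/
abbrev Space (d : ℕ) : Type := EuclideanSpace ℝ (Fin d)

/-- The shifted set `Ω(s) = {x : x - s ∈ Ω}`. -/
def shift {d : ℕ} (Ω : Set (Space d)) (s : Space d) : Set (Space d) :=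
  {x | x - s ∈ Ω}

/-- The Fourier transform `F(ω) = ∫ f(r) exp(-i⟪ω, r⟫) dr` (angular frequency, no normalizing
factor) of a square-integrable field `f`. Mathlib's `𝓕` on `L²` is the Plancherel extension of
`∫ f(r) exp(-2πi⟪ξ, r⟫) dr`, so that `F(ω) = (𝓕 f)(ω / 2π)`. -/
def fourierL2 {d : ℕ} (f : Lp ℂ 2 (volume : Measure (Space d))) : Space d → ℂ :=
  fun ω => (𝓕 f : Lp ℂ 2 (volume : Measure (Space d))) ((2 * Real.pi)⁻¹ • ω)

/-- The fields bandlimited to `Ω`: finite energy, and Fourier transform vanishing (almost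
everywhere) outside `Ω`. Fields are evaluated at points, so that the continuous representative of
the `L²` class is meant; it exists and is unique whenever `Ω` is bounded. -/
def bandlimited {d : ℕ} (Ω : Set (Space d)) : Set (Space d → ℂ) :=
  {f | Continuous f ∧ ∃ hf : MemLp f 2 (volume : Measure (Space d)),
    ∀ᵐ ω ∂(volume : Measure (Space d)), ω ∉ Ω → fourierL2 (hf.toLp f) ω = 0}

/-- A set of points whose distinct elements are uniformly separated. -/
def UniformlyDiscrete {d : ℕ} (L : Set (Space d)) : Prop :=
  ∃ r : ℝ, 0 < r ∧ ∀ x ∈ L, ∀ y ∈ L, x ≠ y → r < dist x y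

/-- `L` is uniformly discrete and every field bandlimited to `Ω` is uniquely determined by its
values on `L`. -/
def AdmitsReconstruction {d : ℕ} (Ω : Set (Space d)) (L : Set (Space d)) : Prop :=
  UniformlyDiscrete L ∧
    ∀ f ∈ bandlimited Ω, ∀ g ∈ bandlimited Ω, (∀ x ∈ L, f x = g x) → f = g

/-- A trajectory set: a countable collection of trajectories, that is, of continuous maps
`ℝ → ℝ^d`. -/
structure TrajectorySet (d : ℕ) where
  carrier : Set C(ℝ, Space d)
  countable : carrier.Countable

/-- The points lying on the trajectories. -/
def TrajectorySet.points {d : ℕ} (P : TrajectorySet d) : Set (Space d) :=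
  ⋃ p ∈ P.carrier, range p

/-- The arc length of the part `p|_T` of a curve `p`: the infimum, over all countable coverings of
`T` by intervals, of the sum of the lengths (total variations) of `p` on these intervals. For
continuously differentiable `p` and measurable `T` this is `∫_T ‖p'(t)‖ dt`. -/
def arcLengthOn {d : ℕ} (p : ℝ → Space d) (T : Set ℝ) : ℝ≥0∞ :=
  ⨅ (I : ℕ → Set ℝ) (_ : ∀ n, (I n).OrdConnected) (_ : T ⊆ ⋃ n, I n),
    ∑' n, eVariationOn p (I n)

/-- The total arc length of the trajectories of `P` located within the closed ball of radius `a`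
about `x`. -/
def TrajectorySet.lengthInBall {d : ℕ} (P : TrajectorySet d) (a : ℝ) (x : Space d) : ℝ≥0∞ :=
  ∑' p : P.carrier, arcLengthOn (p : C(ℝ, Space d)) {t | dist ((p : C(ℝ, Space d)) t) x ≤ a}

/-- Nyquist condition: some uniformly discrete set of points on the trajectories admits
reconstruction of all fields bandlimited to `Ω`. -/
def NyquistCondition {d : ℕ} (Ω : Set (Space d)) (P : TrajectorySet d) : Prop :=
  ∃ L : Set (Space d), L ⊆ P.points ∧ AdmitsReconstruction Ω L

/-- Non-degeneracy: for every `x` the part of `P` within the ball of radius `a` about `x` is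
contained in a continuous curve whose length is at most the total arc length of that part plus
`o(a^d)`, as `a → ∞`. -/
def NonDegenerate {d : ℕ} (P : TrajectorySet d) : Prop :=
  ∀ x : Space d, ∃ h : ℝ → ℝ, h =o[atTop] (fun a : ℝ => a ^ d) ∧
    ∀ᶠ a : ℝ in atTop, ∃ γ : ℝ → Space d, ContinuousOn γ (Icc 0 1) ∧
      P.points ∩ Metric.closedBall x a ⊆ γ '' Icc 0 1 ∧
      eVariationOn γ (Icc 0 1) ≤ P.lengthInBall a x + ENNReal.ofReal (h a)

/-- Nyquist trajectory sets for `Ω`. -/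
def IsNyquistTrajectorySet {d : ℕ} (Ω : Set (Space d)) (P : TrajectorySet d) : Prop :=
  NyquistCondition Ω P ∧ NonDegenerate P

/-- The data of a uniform set of equispaced parallel lines in the plane: an offset `w`, a direction
`v ≠ 0`, a unit vector `vperp` orthogonal to `v` and a spacing `Δ > 0`. -/
structure UniformSet where
  w : Space 2
  v : Space 2
  vperp : Space 2
  Δ : ℝ
  v_ne_zero : v ≠ 0
  norm_vperp : ‖vperp‖ = 1
  inner_vperp : inner ℝ vperp v = 0
  Δ_pos : 0 < Δ

/-- The `j`-th line `t ↦ w + j Δ v^⊥ + t v` of a uniform set. -/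
def UniformSet.line (S : UniformSet) (j : ℤ) : C(ℝ, Space 2) where
  toFun t := S.w + ((j : ℝ) * S.Δ) • S.vperp + t • S.v
  continuous_toFun := by fun_prop

/-- The vector `u = 2π v^⊥ / Δ`. -/
def UniformSet.u (S : UniformSet) : Space 2 :=
  (2 * Real.pi / S.Δ) • S.vperp

/-- The trajectory set that is the union of the given uniform sets. -/
def unionOfUniformSets {N : ℕ} (S : Fin N → UniformSet) : TrajectorySet 2 where
  carrier := ⋃ i, range (S i).line
  countable := countable_iUnion fun _ => countable_range _

/-- The set `Q` of all points `∑ i, (-1)^{k i} u_i / 2` with `k i ∈ {0, 1}`. -/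
def signPoints {N : ℕ} (S : Fin N → UniformSet) : Set (Space 2) :=
  range fun k : Fin N → Fin 2 => ∑ i, ((-1 : ℝ) ^ (k i : ℕ)) • ((2⁻¹ : ℝ) • (S i).u)

end

noncomputable section

/-! A field bandlimited to the compact set `Ω` is the inverse Fourier integral of an integrable `g`
supported in `Ω / 2π` (`exists_fourier_representation`). If it vanishes on a shifted lattice, the
sum of `g` over translates by the dual lattice, up to phases, vanishes, so almost every point of the
support of `g` has another support point in its dual coset (`ae_exists_ne_zero_translate`). Sampling
the lines finely enough makes the dual lattice longer than the support in one direction, so the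
second point differs by a multiple of `freq = u / 2π` only.

For one family, convexity then gives two points of `Ω` differing by exactly `u`, which is a
translate of `Q`. For two families, the support points in a coset form a finite planar lattice set
with no point alone in its row or column. Its convex hull contains a unit square
(`exists_unit_square_of_lattice_points`, by Helly's theorem), again a translate of `Q`. Hence if no
translate of `Ω` contains `Q`, the samples determine the field.

Conversely, multiplying a field of very small band by one sine per family gives a field vanishing on
every line. Expanding the sines moves its spectrum to small neighbourhoods of the points of `Q`, and
a modulation by `s` brings these inside `Ω` (`exists_bandlimited_vanishing`).

Non-degeneracy comes from sweeping each family back and forth. In a disc of radius `a` there are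
`O(a)` lines, and passing between neighbouring chord ends costs `O(√a)`, for a total excess `O(a ^
(3 / 2))` (`UniformSet.exists_coveredByCurve`). -/

/-! ### Bandlimited fields as Fourier integrals -/

/-- Scaling by a nonzero factor preserves null sets. -/
theorem quasiMeasurePreserving_const_smul {d : ℕ} {c : ℝ} (hc : c ≠ 0) :
    Measure.QuasiMeasurePreserving (fun x : Space d => c • x) volume volume := by
  refine ⟨measurable_const_smul c, ?_⟩
  rw [Measure.map_addHaar_smul _ hc]
  exact Measure.smul_absolutelyContinuous

/-- If the `L²` Fourier transform of `f` is integrable, then `f` is its inverse Fourier integral. -/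
theorem ae_eq_fourierInv_of_integrable {d : ℕ} (f : Lp ℂ 2 (volume : Measure (Space d)))
    (hg : Integrable (𝓕 f : Lp ℂ 2 (volume : Measure (Space d))) volume) :
    (f : Space d → ℂ) =ᵐ[volume]
      𝓕⁻ ((𝓕 f : Lp ℂ 2 (volume : Measure (Space d))) : Space d → ℂ) := by
  set g : Lp ℂ 2 (volume : Measure (Space d)) := 𝓕 f with hgdef
  have hcont : Continuous (𝓕⁻ (g : Space d → ℂ)) := by
    have := (Real.Lp.fourierTransformInv (memLp_one_iff_integrable.2 hg).toLp).continuous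
    rwa [Real.Lp.fourierTransformInv_toLp] at this
  refine ae_eq_of_integral_contDiff_smul_eq ((Lp.memLp f).locallyIntegrable (by norm_num))
    hcont.locallyIntegrable fun φ hφ hφc => ?_
  have hφ' : ContDiff ℝ ((⊤ : ℕ∞) : WithTop ℕ∞) (fun x => (φ x : ℂ)) := Complex.ofRealCLM.contDiff.comp hφ
  have hφc' : HasCompactSupport (fun x => (φ x : ℂ)) := hφc.comp_left (g := Complex.ofReal) rfl
  set ψ : SchwartzMap (Space d) ℂ := hφc'.toSchwartzMap hφ' with hψ
  have hψa : ∀ x, ψ x = (φ x : ℂ) := fun x => rfl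
  -- Fourier inversion holds for tempered distributions; integrability of `g` then lets Fubini move
  -- the transform from the test function back onto `g`.
  have h1 : (Lp.toTemperedDistribution f) ψ = (Lp.toTemperedDistribution g) (𝓕⁻ ψ) := by
    rw [← TemperedDistribution.fourierInv_apply, Lp.fourierInv_toTemperedDistribution_eq, hgdef,
      FourierTransform.fourierInv_fourier_eq]
  rw [Lp.toTemperedDistribution_apply, Lp.toTemperedDistribution_apply] at h1
  have h2 := VectorFourier.integral_fourierIntegral_smul_eq_flip (μ := volume) (ν := volume)
    (L := -(innerₗ (Space d))) (e := Real.fourierChar) (f := ψ) (g := g)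
    Real.continuous_fourierChar
    (continuous_inner.neg : Continuous fun p : Space d × Space d => -inner ℝ p.1 p.2) ψ.integrable hg
  have e1 : ∀ ξ, (𝓕⁻ ψ) ξ =
      VectorFourier.fourierIntegral Real.fourierChar volume (-(innerₗ (Space d))) ψ ξ := by
    intro ξ
    rw [SchwartzMap.fourierInv_coe, Real.fourierInv_eq]
    simp [VectorFourier.fourierIntegral]
  have e2 : ∀ x, 𝓕⁻ (g : Space d → ℂ) x = VectorFourier.fourierIntegral Real.fourierChar volume
      (-(innerₗ (Space d))).flip g x := by
    intro ξ
    rw [Real.fourierInv_eq]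
    simp [VectorFourier.fourierIntegral, real_inner_comm]
  simp_rw [e1] at h1
  rw [h2] at h1
  simp_rw [← e2, hψa] at h1
  simpa [Complex.real_smul] using h1

/-- A field bandlimited to a bounded set is a Fourier integral over that set. -/
theorem exists_fourier_representation {d : ℕ} {Ω : Set (Space d)} (hΩ : IsCompact Ω)
    {f : Space d → ℂ} (hf : f ∈ bandlimited Ω) :
    ∃ g : Space d → ℂ, Measurable g ∧ Integrable g ∧
      (∀ ξ, (2 * Real.pi) • ξ ∉ Ω → g ξ = 0) ∧ f = 𝓕⁻ g := by
  obtain ⟨hc, hm, hz⟩ := hf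
  set q : Lp ℂ 2 (volume : Measure (Space d)) := 𝓕 (hm.toLp f) with hq
  have hpi : (2 * Real.pi) ≠ 0 := by positivity
  have hcl : IsClosed {ξ : Space d | (2 * Real.pi) • ξ ∈ Ω} :=
    hΩ.isClosed.preimage (continuous_const_smul _)
  have hK : IsCompact {ξ : Space d | (2 * Real.pi) • ξ ∈ Ω} :=
    (Homeomorph.smulOfNeZero (2 * Real.pi) hpi).isCompact_preimage.2 hΩ
  have hz' : ∀ᵐ ξ : Space d, (2 * Real.pi) • ξ ∉ Ω → q ξ = 0 := by
    filter_upwards [(quasiMeasurePreserving_const_smul hpi).ae hz] with ξ hξ h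
    have := hξ h
    rwa [fourierL2, smul_smul, inv_mul_cancel₀ hpi, one_smul] at this
  -- Cutting off a measurable representative makes the support condition hold everywhere, not just
  -- almost everywhere. On the compact band, square integrability gives integrability.
  let g : Space d → ℂ := {ξ : Space d | (2 * Real.pi) • ξ ∈ Ω}.indicator
    ((Lp.aestronglyMeasurable q).mk q)
  have hgq : g =ᵐ[volume] q := by
    filter_upwards [hz', (Lp.aestronglyMeasurable q).ae_eq_mk] with ξ h1 h2
    by_cases h : (2 * Real.pi) • ξ ∈ Ω
    · rw [h2]
      exact indicator_of_mem (by exact h) _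
    · rw [h1 h]
      exact indicator_of_notMem (by exact h) _
  have hgm : Measurable g :=
    ((Lp.aestronglyMeasurable q).stronglyMeasurable_mk.measurable).indicator hcl.measurableSet
  have hgi : Integrable g := by
    have : IntegrableOn ((Lp.aestronglyMeasurable q).mk q)
        {ξ : Space d | (2 * Real.pi) • ξ ∈ Ω} volume := by
      refine LocallyIntegrable.integrableOn_isCompact ?_ hK
      refine MemLp.locallyIntegrable (p := 2) ?_ (by norm_num)
      exact (memLp_congr_ae (Lp.aestronglyMeasurable q).ae_eq_mk).1 (Lp.memLp q)
    exact this.integrable_indicator hcl.measurableSet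
  have hqi : Integrable q volume := hgi.congr hgq
  refine ⟨g, hgm, hgi, fun ξ hξ => indicator_of_notMem (by exact hξ) _, ?_⟩
  have h1 : 𝓕⁻ g = 𝓕⁻ (q : Space d → ℂ) := funext fun x => Real.fourierInv_congr_ae hgq x
  rw [h1]
  have hcont : Continuous (𝓕⁻ (q : Space d → ℂ)) := by
    have := (Real.Lp.fourierTransformInv (memLp_one_iff_integrable.2 hqi).toLp).continuous
    rwa [Real.Lp.fourierTransformInv_toLp] at this
  refine (hc.ae_eq_iff_eq volume hcont).1 ?_
  exact hm.coeFn_toLp.symm.trans (ae_eq_fourierInv_of_integrable _ hqi)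

theorem sub_mem_bandlimited {d : ℕ} {Ω : Set (Space d)} {f g : Space d → ℂ}
    (hf : f ∈ bandlimited Ω) (hg : g ∈ bandlimited Ω) : f - g ∈ bandlimited Ω := by
  obtain ⟨hc, hm, hz⟩ := hf
  obtain ⟨hc', hm', hz'⟩ := hg
  refine ⟨hc.sub hc', hm.sub hm', ?_⟩
  have hpi : (2 * Real.pi)⁻¹ ≠ 0 := by positivity
  have e : (𝓕 ((hm.sub hm').toLp (f - g)) : Lp ℂ 2 (volume : Measure (Space d)))
      = 𝓕 (hm.toLp f) - 𝓕 (hm'.toLp g) := by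
    rw [MemLp.toLp_sub]
    exact map_sub (Lp.fourierTransformₗᵢ (Space d) ℂ) _ _
  have h := (quasiMeasurePreserving_const_smul hpi).ae
    (Lp.coeFn_sub (𝓕 (hm.toLp f)) (𝓕 (hm'.toLp g)))
  filter_upwards [hz, hz', h] with ω h1 h2 h3 hω
  have h1 := h1 hω
  have h2 := h2 hω
  unfold fourierL2 at *
  rw [e, h3, Pi.sub_apply, h1, h2, sub_zero]

/-! ### Periodization over the dual lattice -/

/-- The integral is a bounded functional of `φ`, with bound the L¹ norm of `G`, and trigonometric
polynomials are dense in the continuous functions on the torus. -/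
theorem integral_mul_comp_eq_zero_of_mFourier {X ι : Type*} [Fintype ι] [MeasurableSpace X]
    {μ : Measure X} {p : X → UnitAddTorus ι} (hp : Measurable p) {G : X → ℂ}
    (hG : Integrable G μ) (h : ∀ n : ι → ℤ, ∫ x, G x * UnitAddTorus.mFourier n (p x) ∂μ = 0)
    (φ : C(UnitAddTorus ι, ℂ)) : ∫ x, G x * φ (p x) ∂μ = 0 := by
  have hint : ∀ φ : C(UnitAddTorus ι, ℂ), Integrable (fun x => G x * φ (p x)) μ := fun φ => by
    refine hG.mul_bdd (c := ‖φ‖) (φ.continuous.measurable.comp hp).aestronglyMeasurable ?_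
    exact ae_of_all _ fun x => φ.norm_coe_le_norm _
  let L : C(UnitAddTorus ι, ℂ) →ₗ[ℂ] ℂ :=
    { toFun := fun φ => ∫ x, G x * φ (p x) ∂μ
      map_add' := fun φ ψ => by
        simp only [ContinuousMap.add_apply, mul_add]
        exact integral_add (hint φ) (hint ψ)
      map_smul' := fun c φ => by
        simp only [ContinuousMap.smul_apply, smul_eq_mul, RingHom.id_apply]
        rw [← integral_const_mul]
        exact integral_congr_ae (ae_of_all _ fun x => by ring) }
  let L' : C(UnitAddTorus ι, ℂ) →L[ℂ] ℂ := L.mkContinuous (∫ x, ‖G x‖ ∂μ) fun φ => by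
    rw [← integral_mul_const]
    refine norm_integral_le_of_norm_le (hG.norm.mul_const _) (ae_of_all _ fun x => ?_)
    rw [norm_mul]
    gcongr
    exact φ.norm_coe_le_norm _
  have h0 : L' = 0 := by
    refine ContinuousLinearMap.ext_on (s := range (UnitAddTorus.mFourier (d := ι))) ?_ ?_
    · exact Submodule.dense_iff_topologicalClosure_eq_top.2
        UnitAddTorus.span_mFourier_closure_eq_top
    · rintro _ ⟨n, rfl⟩
      exact h n
  exact congrArg (fun T : C(UnitAddTorus ι, ℂ) →L[ℂ] ℂ => T φ) h0

/-- An integrable function whose Fourier coefficients along a map to the torus all vanish has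
integral zero over the preimage of every measurable set. -/
theorem setIntegral_preimage_eq_zero_of_mFourier {X ι : Type*} [Fintype ι] [MeasurableSpace X]
    {μ : Measure X} {p : X → UnitAddTorus ι} (hp : Measurable p) {G : X → ℂ}
    (hG : Integrable G μ) (h : ∀ n : ι → ℤ, ∫ x, G x * UnitAddTorus.mFourier n (p x) ∂μ = 0)
    {B : Set (UnitAddTorus ι)} (hB : MeasurableSet B) : ∫ x in p ⁻¹' B, G x ∂μ = 0 := by
  -- Pushing `|G| μ` forward to the torus turns the error of replacing the indicator of `B` by a
  -- continuous function into an L¹ distance, which can be made small.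
  let ρ : Measure X := μ.withDensity fun x => (‖G x‖₊ : ℝ≥0∞)
  have hρ : IsFiniteMeasure ρ := isFiniteMeasure_withDensity hG.2.ne
  let ν : Measure (UnitAddTorus ι) := ρ.map p
  have hν : IsFiniteMeasure ν := Measure.isFiniteMeasure_map ρ p
  have hind : Integrable (B.indicator fun _ => (1 : ℂ)) ν :=
    (integrable_const _).indicator hB
  rw [← norm_le_zero_iff]
  refine le_of_forall_pos_le_add fun ε hε => ?_
  rw [zero_add]
  obtain ⟨φ, hφ, -⟩ := hind.exists_boundedContinuous_integral_sub_le hε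
  have e1 : ∫ x in p ⁻¹' B, G x ∂μ =
      ∫ x, G x * (B.indicator (fun _ => (1 : ℂ)) (p x) - φ (p x)) ∂μ := by
    have h1 : Integrable (fun x => G x * B.indicator (fun _ => (1 : ℂ)) (p x)) μ := by
      refine (hG.indicator (hp hB)).congr (ae_of_all _ fun x => ?_)
      by_cases hx : p x ∈ B <;> simp [indicator, hx]
    have h2 : Integrable (fun x => G x * φ (p x)) μ := by
      refine hG.mul_bdd (c := ‖φ‖) (φ.continuous.measurable.comp hp).aestronglyMeasurable ?_
      exact ae_of_all _ fun x => φ.norm_coe_le_norm _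
    have h3 : ∫ x, G x * φ (p x) ∂μ = 0 :=
      integral_mul_comp_eq_zero_of_mFourier hp hG h φ.toContinuousMap
    simp only [mul_sub]
    rw [integral_sub h1 h2, h3, sub_zero, ← integral_indicator (hp hB)]
    refine integral_congr_ae (ae_of_all _ fun x => ?_)
    by_cases hx : p x ∈ B <;> simp [indicator, hx]
  have hmeas : Measurable fun y => B.indicator (fun _ => (1 : ℂ)) y - φ y :=
    (measurable_const.indicator hB).sub φ.continuous.measurable
  have e2 : ∫ y, ‖B.indicator (fun _ => (1 : ℂ)) y - φ y‖ ∂ν =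
      ∫ x, ‖G x * (B.indicator (fun _ => (1 : ℂ)) (p x) - φ (p x))‖ ∂μ := by
    rw [integral_map hp.aemeasurable hmeas.norm.aestronglyMeasurable,
      integral_withDensity_eq_integral_smul₀ hG.1.nnnorm.aemeasurable]
    refine integral_congr_ae (ae_of_all _ fun x => ?_)
    simp [NNReal.smul_def]
  rw [e1]
  exact (norm_integral_le_integral_norm _).trans (e2 ▸ hφ)

/-- If the inverse Fourier integral of `g` vanishes on a shifted lattice, then almost no nonzero
value of `g` is isolated among the translates by the dual lattice. -/
theorem ae_exists_ne_zero_translate {d : ℕ} {ι : Type*} [Fintype ι] {U E : ι → Space d}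
    (hdual : ∀ ξ : Space d, ∑ i, (inner ℝ ξ (E i)) • U i = ξ) {g : Space d → ℂ}
    (hgm : Measurable g) (hg : Integrable g) (x₀ : Space d)
    (hz : ∀ n : ι → ℤ, 𝓕⁻ g (x₀ + ∑ i, (n i : ℝ) • E i) = 0) :
    ∀ᵐ ξ : Space d, g ξ ≠ 0 → ∃ n : ι → ℤ, n ≠ 0 ∧ g (ξ + ∑ i, (n i : ℝ) • U i) ≠ 0 := by
  -- The fibres of `p` are the cosets of the lattice spanned by `U`; the Fourier coefficients of `G`
  -- along `p` are the sample values.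
  let p : Space d → UnitAddTorus ι := fun ξ i => ((inner ℝ ξ (E i) : ℝ) : UnitAddCircle)
  have hp : Measurable p := by
    refine Continuous.measurable (continuous_pi fun i => ?_)
    exact (AddCircle.continuous_mk' 1).comp (by fun_prop)
  let G : Space d → ℂ := fun ξ => (Real.fourierChar (inner ℝ ξ x₀) : ℂ) * g ξ
  have hGm : Measurable G := by
    refine Measurable.mul (Continuous.measurable ?_) hgm
    exact continuous_subtype_val.comp (Real.continuous_fourierChar.comp (by fun_prop))
  have hG0 : ∀ ξ, G ξ = 0 ↔ g ξ = 0 := fun ξ => by simp [G]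
  have hG : Integrable G := by
    refine (integrable_norm_iff hGm.aestronglyMeasurable).1 ?_
    simp only [G, norm_mul, Circle.norm_coe, one_mul]
    exact hg.norm
  have hcoef : ∀ n : ι → ℤ, ∫ ξ, G ξ * UnitAddTorus.mFourier n (p ξ) = 0 := by
    intro n
    rw [← hz n, Real.fourierInv_eq]
    refine integral_congr_ae (ae_of_all _ fun ξ => ?_)
    simp only [G, p, UnitAddTorus.mFourier, ContinuousMap.coe_mk, inner_add_right, inner_sum,
      inner_smul_right, Circle.smul_def, smul_eq_mul, fourier_coe_apply, Real.fourierChar_apply,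
      ← Complex.exp_sum, AddChar.map_add_eq_mul, Circle.coe_mul]
    rw [mul_right_comm]
    congr 3
    push_cast
    rw [Finset.mul_sum, Finset.sum_mul]
    refine Finset.sum_congr rfl fun i _ => ?_
    ring
  let ℓ : (ι → ℤ) → Space d := fun n => ∑ i, (n i : ℝ) • U i
  have hℓadd : ∀ m n, ℓ (m + n) = ℓ m + ℓ n := fun m n => by
    simp [ℓ, add_smul, Finset.sum_add_distrib]
  have hℓneg : ∀ n, ℓ (-n) = -ℓ n := fun n => by simp [ℓ]
  -- A measurable choice of one point in each coset. It shows that every measurable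
  -- lattice-invariant set is the preimage of a measurable subset of the torus.
  let s : UnitAddTorus ι → Space d :=
    fun τ => ∑ i, ((AddCircle.measurableEquivIco 1 0 (τ i) : Ico (0 : ℝ) (0 + 1)) : ℝ) • U i
  have hs : Measurable s := by
    refine Finset.measurable_sum _ fun i _ => Measurable.smul_const ?_ _
    exact measurable_subtype_coe.comp
      ((AddCircle.measurableEquivIco 1 0).measurable.comp (measurable_pi_apply i))
  have hsp : ∀ ξ, ∃ n, s (p ξ) = ξ + ℓ n := by
    intro ξ
    refine ⟨fun i => -⌊inner ℝ ξ (E i)⌋, ?_⟩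
    conv_rhs => rw [← hdual ξ]
    simp only [s, ℓ, ← Finset.sum_add_distrib, ← add_smul]
    refine Finset.sum_congr rfl fun i _ => ?_
    congr 1
    have := AddCircle.coe_equivIco_mk_apply (1 : ℝ) (inner ℝ ξ (E i))
    rw [div_one, mul_one] at this
    simp only [hdual]
    refine Eq.trans this ?_
    rw [Int.fract]; push_cast; ring
  let A : Set (Space d) := {ξ | ∀ n : ι → ℤ, n ≠ 0 → G (ξ + ℓ n) = 0}
  have hA : MeasurableSet A := by
    have : A = ⋂ n : ι → ℤ, ⋂ _ : n ≠ 0, (fun ξ => G (ξ + ℓ n)) ⁻¹' {0} := by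
      ext; simp [A]
    rw [this]
    exact MeasurableSet.iInter fun n => MeasurableSet.iInter fun _ =>
      (hGm.comp (measurable_add_const _)) (measurableSet_singleton 0)
  have key : ∀ A' : Set (Space d), MeasurableSet A' → ∫ ξ in A' ∩ A, G ξ = 0 := by
    intro A' hA'
    -- The saturation of `A' ∩ A` adds only points where `G` vanishes, by definition of `A`; and
    -- over an invariant set `G` integrates to zero.
    let T : Set (Space d) := ⋃ n : ι → ℤ, (fun ξ => ξ + ℓ n) ⁻¹' (A' ∩ A)
    have hT : MeasurableSet T :=
      MeasurableSet.iUnion fun n => measurable_add_const _ (hA'.inter hA)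
    have hTinv : ∀ ξ n, ξ + ℓ n ∈ T ↔ ξ ∈ T := by
      intro ξ n
      simp only [T, mem_iUnion, mem_preimage, add_assoc, ← hℓadd]
      exact ⟨fun ⟨m, hm⟩ => ⟨_, hm⟩, fun ⟨m, hm⟩ => ⟨-n + m, by rwa [add_neg_cancel_left]⟩⟩
    have hTp : p ⁻¹' (s ⁻¹' T) = T := by
      ext ξ
      obtain ⟨n, hn⟩ := hsp ξ
      rw [mem_preimage, mem_preimage, hn, hTinv]
    have h0 := setIntegral_preimage_eq_zero_of_mFourier hp hG hcoef (hs hT)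
    rw [hTp] at h0
    rw [← h0]
    refine (setIntegral_eq_of_subset_of_forall_sdiff_eq_zero hT ?_ ?_).symm
    · exact fun ξ hξ => mem_iUnion.2 ⟨0, by simpa [ℓ] using hξ⟩
    · rintro ξ ⟨hξT, hξ⟩
      obtain ⟨n, hn⟩ := mem_iUnion.1 hξT
      have hn0 : n ≠ 0 := by
        rintro rfl
        exact hξ (by simpa [ℓ] using hn)
      have := hn.2 (-n) (neg_ne_zero.2 hn0)
      rwa [hℓneg, add_neg_cancel_right] at this
  have hae : A.indicator G =ᵐ[volume] 0 := by
    refine (hG.indicator hA).ae_eq_zero_of_forall_setIntegral_eq_zero fun A' hA' _ => ?_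
    rw [setIntegral_indicator hA]
    exact key A' hA'
  filter_upwards [hae] with ξ hξ hgξ
  by_contra! hcon
  have hmem : ξ ∈ A := fun n hn => (hG0 _).2 (hcon n hn)
  rw [indicator_of_mem hmem] at hξ
  exact hgξ ((hG0 ξ).1 hξ)

/-! ### Unit squares in planar convex sets -/

/-- A segment joining the bottom of a box to its top meets a segment joining its left side to its
right side. -/
theorem segment_inter_segment_nonempty {a₀ a₁ b₀ b₁ : ℝ × ℝ} (hb : b₀.1 < b₁.1)
    (ha₀ : a₀.1 ∈ Icc b₀.1 b₁.1) (ha₁ : a₁.1 ∈ Icc b₀.1 b₁.1)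
    (hb₀ : b₀.2 ∈ Icc a₀.2 a₁.2) (hb₁ : b₁.2 ∈ Icc a₀.2 a₁.2) :
    (segment ℝ a₀ a₁ ∩ segment ℝ b₀ b₁).Nonempty := by
  have hd : 0 < b₁.1 - b₀.1 := sub_pos.2 hb
  let x : ℝ → ℝ := fun τ => a₀.1 + τ * (a₁.1 - a₀.1)
  let σ : ℝ → ℝ := fun τ => (x τ - b₀.1) / (b₁.1 - b₀.1)
  let q : ℝ → ℝ := fun τ => a₀.2 + τ * (a₁.2 - a₀.2) - (b₀.2 + σ τ * (b₁.2 - b₀.2))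
  have hq : ContinuousOn q (Icc 0 1) := by
    refine Continuous.continuousOn ?_
    simp only [q, σ, x]
    fun_prop
  have hσ : ∀ τ ∈ Icc (0 : ℝ) 1, σ τ ∈ Icc (0 : ℝ) 1 := by
    intro τ hτ
    have h1 : x τ ∈ Icc b₀.1 b₁.1 := by
      have := (convex_Icc b₀.1 b₁.1) ha₀ ha₁ (sub_nonneg.2 hτ.2) hτ.1 (by ring)
      simp only [smul_eq_mul] at this
      convert this using 1
      simp only [x]; ring
    exact ⟨div_nonneg (sub_nonneg.2 h1.1) hd.le,
      (div_le_one hd).2 (sub_le_sub_right h1.2 _)⟩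
  have hy : ∀ τ ∈ Icc (0 : ℝ) 1, b₀.2 + σ τ * (b₁.2 - b₀.2) ∈ Icc a₀.2 a₁.2 := by
    intro τ hτ
    have := (convex_Icc a₀.2 a₁.2) hb₀ hb₁ (sub_nonneg.2 (hσ τ hτ).2) (hσ τ hτ).1 (by ring)
    simp only [smul_eq_mul] at this
    convert this using 1
    ring
  have h0 : q 0 ≤ 0 := by
    have := (hy 0 ⟨le_rfl, zero_le_one⟩).1
    simp only [q]; linarith
  have h1 : 0 ≤ q 1 := by
    have := (hy 1 ⟨zero_le_one, le_rfl⟩).2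
    simp only [q]; linarith
  obtain ⟨τ, hτ, hτ0⟩ := intermediate_value_Icc zero_le_one hq ⟨h0, h1⟩
  refine ⟨(x τ, a₀.2 + τ * (a₁.2 - a₀.2)), ?_, ?_⟩
  · refine ⟨1 - τ, τ, sub_nonneg.2 hτ.2, hτ.1, by ring, ?_⟩
    ext <;> simp [x] <;> ring
  · refine ⟨1 - σ τ, σ τ, sub_nonneg.2 (hσ τ hτ).2, (hσ τ hτ).1, by ring, ?_⟩
    have hx : σ τ * (b₁.1 - b₀.1) = x τ - b₀.1 := div_mul_cancel₀ _ hd.ne'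
    simp only [q] at hτ0
    ext
    · simp; linarith
    · simp; linarith

/-- A planar convex set that touches each side of a box in a unit segment contains a unit
square. -/
theorem exists_unit_square_of_unit_sides {C : Set (ℝ × ℝ)} (hC : Convex ℝ C)
    {l r m M x y x' y' : ℝ} (hx : x ∈ Icc l (r - 1)) (hx' : x' ∈ Icc l (r - 1))
    (hy : y ∈ Icc m (M - 1)) (hy' : y' ∈ Icc m (M - 1))
    (hb : ∀ t ∈ Icc (0 : ℝ) 1, (x + t, m) ∈ C) (ht : ∀ t ∈ Icc (0 : ℝ) 1, (x' + t, M) ∈ C)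
    (hl : ∀ t ∈ Icc (0 : ℝ) 1, (l, y + t) ∈ C) (hr : ∀ t ∈ Icc (0 : ℝ) 1, (r, y' + t) ∈ C) :
    ∃ p : ℝ × ℝ, ∀ i : Bool × Bool, (p.1 + cond i.1 1 0, p.2 + cond i.2 1 0) ∈ C := by
  -- A common point of these four translates of `C` is the lower left corner of the desired square;
  -- by Helly's theorem any three of them suffice.
  let F : Bool × Bool → Set (ℝ × ℝ) := fun i => (fun p => ((cond i.1 1 0, cond i.2 1 0) + p)) ⁻¹' C
  have hF : ∀ i, Convex ℝ (F i) := fun i => hC.translate_preimage_right _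
  have hc : ∀ b : Bool, (cond b 1 0 : ℝ) ∈ Icc (0 : ℝ) 1 := by rintro (_ | _) <;> simp
  have key : ∀ c : Bool × Bool, ∃ p, ∀ i, i ≠ c → p ∈ F i := by
    intro c
    have h1 := hc !c.1
    have h2 := hc !c.2
    -- The three corners other than `c` are covered by the horizontal and the vertical edge of the
    -- unit square avoiding `c`. The first segment serves both ends of the horizontal edge, the
    -- second both ends of the vertical one, and the two segments cross.
    obtain ⟨p, hpa, hpb⟩ := segment_inter_segment_nonempty
      (a₀ := (x, m - cond (!c.2) 1 0)) (a₁ := (x', M - cond (!c.2) 1 0))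
      (b₀ := (l - cond (!c.1) 1 0, y)) (b₁ := (r - cond (!c.1) 1 0, y'))
      (by simp only; linarith [hx.1, hx.2])
      ⟨by simp only; linarith [hx.1, h1.1], by simp only; linarith [hx.2, h1.2]⟩
      ⟨by simp only; linarith [hx'.1, h1.1], by simp only; linarith [hx'.2, h1.2]⟩
      ⟨by simp only; linarith [hy.1, h2.1], by simp only; linarith [hy.2, h2.2]⟩
      ⟨by simp only; linarith [hy'.1, h2.1], by simp only; linarith [hy'.2, h2.2]⟩
    refine ⟨p, fun i hi => ?_⟩
    by_cases h : i.2 = !c.2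
    · refine (hF i).segment_subset ?_ ?_ hpa
      · have := hb _ (hc i.1)
        simpa [F, h, add_comm] using this
      · have := ht _ (hc i.1)
        simpa [F, h, add_comm] using this
    · have h' : i.1 = !c.1 := by
        have : i.2 = c.2 := by simpa using h
        by_contra h''
        exact hi (Prod.ext (by simpa using h'') this)
      refine (hF i).segment_subset ?_ ?_ hpb
      · have := hl _ (hc i.2)
        simpa [F, h', add_comm] using this
      · have := hr _ (hc i.2)
        simpa [F, h', add_comm] using this
  obtain ⟨p, hp⟩ := Convex.helly_theorem' (𝕜 := ℝ) (F := F) (s := Finset.univ)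
    (fun i _ => hF i) (fun I _ hI => by
      have : ∃ c, c ∉ I := by
        by_contra! h
        have : I = Finset.univ := Finset.eq_univ_iff_forall.2 h
        rw [this] at hI
        simp at hI
      obtain ⟨c, hcI⟩ := this
      obtain ⟨p, hp⟩ := key c
      exact ⟨p, mem_iInter₂.2 fun i hi => hp i fun h => hcI (h ▸ hi)⟩)
  refine ⟨p, fun i => ?_⟩
  have : ((cond i.1 1 0, cond i.2 1 0) + p : ℝ × ℝ) ∈ C :=
    mem_iInter₂.1 hp i (Finset.mem_univ i)
  convert this using 1
  ext <;> simp [add_comm]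

/-- A planar convex set containing a nonempty finite set of lattice points, none of which is alone
in its row or in its column, contains a unit square. -/
theorem exists_unit_square_of_lattice_points {C : Set (ℝ × ℝ)} (hC : Convex ℝ C)
    {S : Set (ℤ × ℤ)} (hfin : S.Finite) (hne : S.Nonempty)
    (hS : ∀ z ∈ S, ((z.1 : ℝ), (z.2 : ℝ)) ∈ C)
    (hrow : ∀ z ∈ S, ∃ z' ∈ S, z'.2 = z.2 ∧ z'.1 ≠ z.1)
    (hcol : ∀ z ∈ S, ∃ z' ∈ S, z'.1 = z.1 ∧ z'.2 ≠ z.2) :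
    ∃ p : ℝ × ℝ, ∀ i : Bool × Bool, (p.1 + cond i.1 1 0, p.2 + cond i.2 1 0) ∈ C := by
  obtain ⟨zl, hzl, hl⟩ := exists_min_image S Prod.fst hfin hne
  obtain ⟨zr, hzr, hr⟩ := exists_max_image S Prod.fst hfin hne
  obtain ⟨zb, hzb, hb⟩ := exists_min_image S Prod.snd hfin hne
  obtain ⟨zt, hzt, ht⟩ := exists_max_image S Prod.snd hfin hne
  have row : ∀ z ∈ S, ∃ x : ℝ, x ∈ Icc (zl.1 : ℝ) (zr.1 - 1) ∧
      ∀ t ∈ Icc (0 : ℝ) 1, (x + t, (z.2 : ℝ)) ∈ C := by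
    have aux : ∀ z ∈ S, ∀ z' ∈ S, z'.2 = z.2 → z.1 < z'.1 →
        ((z.1 : ℝ) ∈ Icc (zl.1 : ℝ) (zr.1 - 1) ∧
          ∀ t ∈ Icc (0 : ℝ) 1, ((z.1 : ℝ) + t, (z.2 : ℝ)) ∈ C) := by
      intro z hz z' hz' h2 h1
      -- Distinct integers are at least one apart, so the segment between the two points contains a
      -- unit segment.
      have h3 : (z.1 : ℝ) + 1 ≤ z'.1 := by exact_mod_cast h1
      have h4 : (z'.1 : ℝ) ≤ zr.1 := by exact_mod_cast hr z' hz'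
      have h5 : (zl.1 : ℝ) ≤ z.1 := by exact_mod_cast hl z hz
      refine ⟨⟨h5, by linarith⟩, fun t ht => hC.segment_subset (hS z hz) (hS z' hz') ?_⟩
      have hd : (0 : ℝ) < z'.1 - z.1 := by linarith
      refine ⟨1 - t / (z'.1 - z.1), t / (z'.1 - z.1), ?_, div_nonneg ht.1 hd.le, by ring, ?_⟩
      · rw [sub_nonneg, div_le_one hd]
        linarith [ht.2]
      · ext
        · simp; field_simp; ring
        · simp [h2]; ring
    intro z hz
    obtain ⟨z', hz', h2, h1⟩ := hrow z hz
    rcases lt_or_gt_of_ne h1 with h | h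
    · obtain ⟨h3, h4⟩ := aux z' hz' z hz h2.symm h
      exact ⟨_, h3, by simpa [h2] using h4⟩
    · exact ⟨_, aux z hz z' hz' h2 h⟩
  have col : ∀ z ∈ S, ∃ y : ℝ, y ∈ Icc (zb.2 : ℝ) (zt.2 - 1) ∧
      ∀ t ∈ Icc (0 : ℝ) 1, ((z.1 : ℝ), y + t) ∈ C := by
    have aux : ∀ z ∈ S, ∀ z' ∈ S, z'.1 = z.1 → z.2 < z'.2 →
        ((z.2 : ℝ) ∈ Icc (zb.2 : ℝ) (zt.2 - 1) ∧
          ∀ t ∈ Icc (0 : ℝ) 1, ((z.1 : ℝ), (z.2 : ℝ) + t) ∈ C) := by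
      intro z hz z' hz' h2 h1
      have h3 : (z.2 : ℝ) + 1 ≤ z'.2 := by exact_mod_cast h1
      have h4 : (z'.2 : ℝ) ≤ zt.2 := by exact_mod_cast ht z' hz'
      have h5 : (zb.2 : ℝ) ≤ z.2 := by exact_mod_cast hb z hz
      refine ⟨⟨h5, by linarith⟩, fun t ht => hC.segment_subset (hS z hz) (hS z' hz') ?_⟩
      have hd : (0 : ℝ) < z'.2 - z.2 := by linarith
      refine ⟨1 - t / (z'.2 - z.2), t / (z'.2 - z.2), ?_, div_nonneg ht.1 hd.le, by ring, ?_⟩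
      · rw [sub_nonneg, div_le_one hd]
        linarith [ht.2]
      · ext
        · simp [h2]; ring
        · simp; field_simp; ring
    intro z hz
    obtain ⟨z', hz', h2, h1⟩ := hcol z hz
    rcases lt_or_gt_of_ne h1 with h | h
    · obtain ⟨h3, h4⟩ := aux z' hz' z hz h2.symm h
      exact ⟨_, h3, by simpa [h2] using h4⟩
    · exact ⟨_, aux z hz z' hz' h2 h⟩
  obtain ⟨x, hx, hbC⟩ := row zb hzb
  obtain ⟨x', hx', htC⟩ := row zt hzt
  obtain ⟨y, hy, hlC⟩ := col zl hzl
  obtain ⟨y', hy', hrC⟩ := col zr hzr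
  exact exists_unit_square_of_unit_sides hC hx hx' hy hy' hbC htC hlC hrC

/-! ### Dual bases and sampling lattices -/

theorem sum_inner_smul_of_biorthogonal {d : ℕ} {U E : Fin d → Space d}
    (h : ∀ i j, inner ℝ (U i) (E j) = if i = j then (1 : ℝ) else 0) (ξ : Space d) :
    ∑ i, (inner ℝ ξ (E i)) • U i = ξ := by
  have hc : ∀ (c : Fin d → ℝ) j, inner ℝ (∑ i, c i • U i) (E j) = c j := fun c j => by
    simp [sum_inner, inner_smul_left, h]
  have hli : LinearIndependent ℝ U := by
    refine Fintype.linearIndependent_iff.2 fun c hc0 j => ?_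
    rw [← hc c j, hc0, inner_zero_left]
  have hspan : Submodule.span ℝ (range U) = ⊤ :=
    hli.span_eq_top_of_card_eq_finrank' (by simp)
  have hξ : ξ ∈ Submodule.span ℝ (range U) := hspan ▸ Submodule.mem_top
  obtain ⟨c, rfl⟩ := (Submodule.mem_span_range_iff_exists_fun ℝ).1 hξ
  simp_rw [hc]

/-- Biorthogonality of the pairs `(U₁, U₂)` and `(E₁, E₂)`. -/
structure Biorthogonal (U₁ U₂ E₁ E₂ : Space 2) : Prop where
  one_one : inner ℝ U₁ E₁ = (1 : ℝ)
  one_two : inner ℝ U₁ E₂ = (0 : ℝ)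
  two_one : inner ℝ U₂ E₁ = (0 : ℝ)
  two_two : inner ℝ U₂ E₂ = (1 : ℝ)

theorem Biorthogonal.swap {U₁ U₂ E₁ E₂ : Space 2} (h : Biorthogonal U₁ U₂ E₁ E₂) :
    Biorthogonal U₂ U₁ E₂ E₁ :=
  ⟨h.two_two, h.two_one, h.one_two, h.one_one⟩

/-- The difference of two distinct points pairs with `U₁` or `U₂` to a nonzero multiple of `1 / n`;
Cauchy–Schwarz bounds its length from below. -/
theorem Biorthogonal.uniformlyDiscrete {U₁ U₂ E₁ E₂ : Space 2}
    (h : Biorthogonal U₁ U₂ E₁ E₂) (x₀ : Space 2) {n : ℕ} (hn : 0 < n) :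
    UniformlyDiscrete
      (range fun z : ℤ × ℤ => x₀ + ((z.1 : ℝ) / n) • E₁ + ((z.2 : ℝ) / n) • E₂) := by
  have hn' : (0 : ℝ) < n := by exact_mod_cast hn
  have hpos : 0 < (n : ℝ) * (‖U₁‖ + ‖U₂‖ + 1) := by positivity
  have key : ∀ (U x y : Space 2) (k : ℤ), k ≠ 0 → inner ℝ U (x - y) = (k : ℝ) / n →
      ‖U‖ < ‖U₁‖ + ‖U₂‖ + 1 → 1 / (n * (‖U₁‖ + ‖U₂‖ + 1)) < dist x y := by
    intro U x y k hk hU hlt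
    have h1 : (1 : ℝ) ≤ |(k : ℝ)| := by exact_mod_cast Int.one_le_abs hk
    have h2 : |(k : ℝ)| / n ≤ ‖U‖ * dist x y := by
      have := abs_real_inner_le_norm U (x - y)
      rwa [hU, abs_div, Nat.abs_cast, ← dist_eq_norm] at this
    have h3 : (1 : ℝ) ≤ n * (‖U‖ * dist x y) := by
      rw [div_le_iff₀ hn'] at h2
      linarith
    have hd : 0 < dist x y := by
      by_contra hcon
      have : dist x y = 0 := le_antisymm (not_lt.1 hcon) dist_nonneg
      rw [this] at h3
      norm_num at h3
    rw [div_lt_iff₀ hpos]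
    calc (1 : ℝ) ≤ n * (‖U‖ * dist x y) := h3
      _ < n * ((‖U₁‖ + ‖U₂‖ + 1) * dist x y) := by gcongr
      _ = dist x y * (n * (‖U₁‖ + ‖U₂‖ + 1)) := by ring
  refine ⟨1 / (n * (‖U₁‖ + ‖U₂‖ + 1)), by positivity, ?_⟩
  rintro _ ⟨a, rfl⟩ _ ⟨b, rfl⟩ hab
  by_cases h1 : a.1 = b.1
  · have h2 : a.2 - b.2 ≠ 0 := fun h2 => hab (by rw [show a = b from Prod.ext h1 (sub_eq_zero.1 h2)])
    refine key U₂ _ _ (a.2 - b.2) h2 ?_ (by linarith [norm_nonneg U₁])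
    simp only [inner_sub_right, inner_add_right, inner_smul_right, h.two_one, h.two_two]
    push_cast; ring
  · refine key U₁ _ _ (a.1 - b.1) (sub_ne_zero.2 h1) ?_ (by linarith [norm_nonneg U₂])
    simp only [inner_sub_right, inner_add_right, inner_smul_right, h.one_one, h.one_two]
    push_cast; ring

/-- If the inverse Fourier integral of `g` vanishes at sufficiently dense samples of the lines
`x₀ + j E₁ + ℝ E₂`, then almost no nonzero value of `g` is isolated among its translates by
multiples of `U₁`. -/
theorem Biorthogonal.ae_exists_ne_zero {U₁ U₂ E₁ E₂ : Space 2}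
    (h : Biorthogonal U₁ U₂ E₁ E₂) {K : Set (Space 2)} {n : ℕ} (hn : 0 < n)
    (hK : ∀ x ∈ K, ∀ y ∈ K, |inner ℝ (y - x) E₂| < (n : ℝ)) {g : Space 2 → ℂ}
    (hgm : Measurable g) (hg : Integrable g) (hgK : ∀ ξ, ξ ∉ K → g ξ = 0) (x₀ : Space 2)
    (hz : ∀ j k : ℤ, 𝓕⁻ g (x₀ + (j : ℝ) • E₁ + ((k : ℝ) / n) • E₂) = 0) :
    ∀ᵐ ξ : Space 2, g ξ ≠ 0 → ∃ m : ℤ, m ≠ 0 ∧ g (ξ + (m : ℝ) • U₁) ≠ 0 := by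
  have hn' : (n : ℝ) ≠ 0 := by exact_mod_cast hn.ne'
  -- Refining the samples along `E₂` by `n` stretches the dual vector to `n • U₂`, too long for two
  -- points of `K` to differ by it.
  have hdual : ∀ ξ, ∑ i, (inner ℝ ξ (![E₁, (n : ℝ)⁻¹ • E₂] i)) • ![U₁, (n : ℝ) • U₂] i = ξ := by
    refine sum_inner_smul_of_biorthogonal fun i j => ?_
    fin_cases i <;> fin_cases j <;>
      simp [inner_smul_left, inner_smul_right, h.one_one, h.one_two, h.two_one, h.two_two, hn']
  have hae := ae_exists_ne_zero_translate hdual hgm hg x₀ fun k => by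
    rw [← hz (k 0) (k 1)]
    simp [Fin.sum_univ_two, smul_smul, add_assoc, div_eq_mul_inv]
  filter_upwards [hae] with ξ hξ hgξ
  obtain ⟨k, hk, hk'⟩ := hξ hgξ
  rw [Fin.sum_univ_two] at hk'
  simp only [Matrix.cons_val_zero, Matrix.cons_val_one] at hk'
  have h1 := hK _ (not_not.1 fun h' => hgξ (hgK _ h')) _ (not_not.1 fun h' => hk' (hgK _ h'))
  rw [add_sub_cancel_left, inner_add_left, inner_smul_left, inner_smul_left, inner_smul_left,
    h.one_two, h.two_two] at h1
  simp only [conj_trivial, mul_zero, zero_add, mul_one, abs_mul, Nat.abs_cast] at h1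
  have hk1 : k 1 = 0 := by
    by_contra hne
    have : (1 : ℝ) ≤ |(k 1 : ℝ)| := by exact_mod_cast Int.one_le_abs hne
    nlinarith [(Nat.cast_pos (α := ℝ)).2 hn]
  refine ⟨k 0, fun h0 => hk ?_, by simpa [hk1] using hk'⟩
  ext i
  fin_cases i
  · exact h0
  · exact hk1

theorem exists_nat_bound_inner {K : Set (Space 2)} (hK : Bornology.IsBounded K) (E : Space 2) :
    ∃ n : ℕ, ∀ x ∈ K, ∀ y ∈ K, |inner ℝ (y - x) E| < (n : ℝ) := by
  obtain ⟨n, hn⟩ := exists_nat_gt (Metric.diam K * ‖E‖)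
  refine ⟨n, fun x hx y hy => (abs_real_inner_le_norm _ _).trans_lt (lt_of_le_of_lt ?_ hn)⟩
  rw [← dist_eq_norm]
  gcongr
  exact Metric.dist_le_diam_of_mem hK hy hx

/-! ### Lines as level sets -/

namespace UniformSet

variable (S : UniformSet)

/-- The frequency vector `v^⊥ / Δ` of a uniform set of lines. -/
def freq : Space 2 := S.Δ⁻¹ • S.vperp

theorem u_eq : S.u = (2 * Real.pi) • S.freq := by
  rw [u, freq, smul_smul, div_eq_mul_inv]

theorem inner_freq_v : inner ℝ S.freq S.v = (0 : ℝ) := by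
  rw [freq, inner_smul_left, S.inner_vperp, mul_zero]

theorem inner_freq_vperp : inner ℝ S.freq (S.Δ • S.vperp) = (1 : ℝ) := by
  rw [freq, inner_smul_left, inner_smul_right, real_inner_self_eq_norm_sq, S.norm_vperp]
  simp [S.Δ_pos.ne']

theorem exists_eq_add_smul_v (z : Space 2) :
    ∃ t : ℝ, z = (inner ℝ S.vperp z : ℝ) • S.vperp + t • S.v := by
  have h1 : S.vperp 0 * S.vperp 0 + S.vperp 1 * S.vperp 1 = 1 := by
    have := real_inner_self_eq_norm_sq S.vperp
    rw [S.norm_vperp, PiLp.inner_apply, Fin.sum_univ_two] at this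
    simp only [RCLike.inner_apply, conj_trivial] at this
    linarith
  have h2 : S.vperp 0 * S.v 0 + S.vperp 1 * S.v 1 = 0 := by
    have := S.inner_vperp
    rw [PiLp.inner_apply, Fin.sum_univ_two] at this
    simp only [RCLike.inner_apply, conj_trivial] at this
    linarith
  set a := S.vperp 0
  set b := S.vperp 1
  set c := S.v 0 with hc
  set d := S.v 1 with hd
  -- In the plane, `v` is a multiple of the quarter turn `(-b, a)` of `v^⊥`; the factor is the
  -- determinant, nonzero because `v` is.
  have hcl : c = -b * (a * d - b * c) := by linear_combination -c * h1 + a * h2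
  have hdl : d = a * (a * d - b * c) := by linear_combination -d * h1 + b * h2
  have hl : a * d - b * c ≠ 0 := by
    intro h0
    rw [h0, mul_zero] at hcl hdl
    refine S.v_ne_zero ?_
    ext i
    fin_cases i
    · exact hcl
    · exact hdl
  have hin : (inner ℝ S.vperp z : ℝ) = a * z 0 + b * z 1 := by
    rw [PiLp.inner_apply, Fin.sum_univ_two]
    simp only [RCLike.inner_apply, conj_trivial]
    ring
  refine ⟨(-b * z 0 + a * z 1) / (a * d - b * c), ?_⟩
  rw [hin]
  ext i
  fin_cases i
  · change z 0 = (a * z 0 + b * z 1) * a + (-b * z 0 + a * z 1) / (a * d - b * c) * c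
    have : (-b * z 0 + a * z 1) / (a * d - b * c) * c = -b * (-b * z 0 + a * z 1) := by
      rw [div_mul_eq_mul_div, div_eq_iff hl]
      linear_combination (-b * z 0 + a * z 1) * hcl
    rw [this]; linear_combination -z 0 * h1
  · change z 1 = (a * z 0 + b * z 1) * b + (-b * z 0 + a * z 1) / (a * d - b * c) * d
    have : (-b * z 0 + a * z 1) / (a * d - b * c) * d = a * (-b * z 0 + a * z 1) := by
      rw [div_mul_eq_mul_div, div_eq_iff hl]
      linear_combination (-b * z 0 + a * z 1) * hdl
    rw [this]; linear_combination -z 1 * h1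

/-- Describes the family as the integer level sets of one linear functional, whose gradient is
`freq`. -/
theorem mem_range_line_iff (j : ℤ) (y : Space 2) :
    y ∈ range (S.line j) ↔ inner ℝ S.freq (y - S.w) = (j : ℝ) := by
  have hΔ := S.Δ_pos.ne'
  constructor
  · rintro ⟨t, rfl⟩
    have : S.line j t - S.w = (j : ℝ) • (S.Δ • S.vperp) + t • S.v := by
      change S.w + ((j : ℝ) * S.Δ) • S.vperp + t • S.v - S.w = _
      rw [smul_smul]; abel
    rw [this, inner_add_right, inner_smul_right, S.inner_freq_vperp, inner_smul_right,
      S.inner_freq_v]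
    ring
  · intro h
    obtain ⟨t, ht⟩ := S.exists_eq_add_smul_v (y - S.w)
    refine ⟨t, ?_⟩
    rw [freq, inner_smul_left, conj_trivial, inv_mul_eq_iff_eq_mul₀ hΔ] at h
    change S.w + ((j : ℝ) * S.Δ) • S.vperp + t • S.v = y
    rw [h] at ht
    rw [mul_comm, add_assoc, ← ht]; abel

end UniformSet

theorem mem_points_unionOfUniformSets {N : ℕ} (S : Fin N → UniformSet) (y : Space 2) :
    y ∈ (unionOfUniformSets S).points ↔
      ∃ i, ∃ j : ℤ, inner ℝ (S i).freq (y - (S i).w) = (j : ℝ) := by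
  simp only [← UniformSet.mem_range_line_iff, TrajectorySet.points, unionOfUniformSets, mem_iUnion]
  constructor
  · rintro ⟨p, ⟨i, j, rfl⟩, hy⟩
    exact ⟨i, j, hy⟩
  · rintro ⟨i, j, hy⟩
    exact ⟨_, ⟨i, j, rfl⟩, hy⟩

/-! ### The Nyquist condition from the absence of a translate of `Q` -/

/-- A set of samples determines all bandlimited fields if every Fourier integral over the band
vanishing at the samples is zero. -/
theorem eq_of_forall_fourierInv {Ω : Set (Space 2)} (hΩ : IsCompact Ω) {L : Set (Space 2)}
    (h : ∀ g : Space 2 → ℂ, Measurable g → Integrable g →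
      (∀ ξ, (2 * Real.pi) • ξ ∉ Ω → g ξ = 0) → (∀ x ∈ L, 𝓕⁻ g x = 0) → ∀ᵐ ξ, g ξ = 0)
    {f f' : Space 2 → ℂ} (hf : f ∈ bandlimited Ω) (hf' : f' ∈ bandlimited Ω)
    (hL : ∀ x ∈ L, f x = f' x) : f = f' := by
  obtain ⟨g, hgm, hg, hgΩ, he⟩ := exists_fourier_representation hΩ (sub_mem_bandlimited hf hf')
  have h0 := h g hgm hg hgΩ fun x hx => by
    rw [← he, Pi.sub_apply, hL x hx, sub_self]
  rw [← sub_eq_zero, he]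
  ext x
  rw [Real.fourierInv_congr_ae (f₂ := fun _ => 0) h0 x, Real.fourierInv_eq]
  simp

theorem isCompact_scaled {Ω : Set (Space 2)} (hΩ : IsCompact Ω) :
    IsCompact {ξ : Space 2 | (2 * Real.pi) • ξ ∈ Ω} :=
  (Homeomorph.smulOfNeZero (2 * Real.pi) (by positivity)).isCompact_preimage.2 hΩ

theorem nyquistCondition_of_one {Ω : Set (Space 2)} (hΩ : IsCompact Ω) (hconv : Convex ℝ Ω)
    (S : Fin 1 → UniformSet) (hQ : ∀ s : Space 2, ¬ signPoints S ⊆ shift Ω s) :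
    NyquistCondition Ω (unionOfUniformSets S) := by
  set T := S 0 with hT
  have hv : ‖T.v‖ ≠ 0 := norm_ne_zero_iff.2 T.v_ne_zero
  have hb : Biorthogonal T.freq ((‖T.v‖ ^ 2)⁻¹ • T.v) (T.Δ • T.vperp) T.v := by
    refine ⟨T.inner_freq_vperp, T.inner_freq_v, ?_, ?_⟩
    · rw [inner_smul_left, inner_smul_right, real_inner_comm, T.inner_vperp]; simp
    · rw [inner_smul_left, real_inner_self_eq_norm_sq]; simp [hv]
  obtain ⟨n₀, hn₀⟩ := exists_nat_bound_inner (isCompact_scaled hΩ).isBounded T.v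
  set n := n₀ + 1
  have hn : 0 < n := Nat.succ_pos _
  have hn' : (n : ℝ) ≠ 0 := by exact_mod_cast hn.ne'
  have hnK : ∀ x ∈ {ξ : Space 2 | (2 * Real.pi) • ξ ∈ Ω},
      ∀ y ∈ {ξ : Space 2 | (2 * Real.pi) • ξ ∈ Ω}, |inner ℝ (y - x) T.v| < (n : ℝ) :=
    fun x hx y hy => (hn₀ x hx y hy).trans (by simp [n])
  refine ⟨range fun z : ℤ × ℤ => T.w + (z.1 : ℝ) • (T.Δ • T.vperp) + ((z.2 : ℝ) / n) • T.v,
    ?_, ?_, fun f hf f' hf' h => eq_of_forall_fourierInv hΩ ?_ hf hf' h⟩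
  · rintro _ ⟨z, rfl⟩
    refine (mem_points_unionOfUniformSets S _).2 ⟨0, z.1, ?_⟩
    beta_reduce
    rw [← hT, add_assoc, add_sub_cancel_left, inner_add_right, inner_smul_right,
      T.inner_freq_vperp, inner_smul_right, T.inner_freq_v]
    ring
  · obtain ⟨r, hr, h⟩ := hb.uniformlyDiscrete T.w hn
    refine ⟨r, hr, ?_⟩
    rintro _ ⟨z, rfl⟩ _ ⟨z', rfl⟩ hne
    -- The samples lie in the lattice refined by `n` in both directions, already known to be
    -- uniformly discrete.
    exact h _ ⟨(n * z.1, z.2), by simp [hn']⟩ _ ⟨(n * z'.1, z'.2), by simp [hn']⟩ hne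
  · intro g hgm hg hgΩ hz
    filter_upwards [hb.ae_exists_ne_zero hn hnK hgm hg hgΩ T.w
      fun j k => hz _ ⟨(j, k), rfl⟩] with ξ hξ
    by_contra hne
    obtain ⟨m, hm, hm'⟩ := hξ hne
    have h0 : (2 * Real.pi) • ξ ∈ Ω := not_not.1 fun h' => hne (hgΩ _ h')
    have h1 : (2 * Real.pi) • ξ + (m : ℝ) • T.u ∈ Ω := by
      have := not_not.1 fun h' => hm' (hgΩ _ h')
      rwa [smul_add, smul_comm, ← T.u_eq] at this
    -- Convexity shortens the step from `m` times `u` to `u`; for negative `m` the two endpoints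
    -- exchange roles.
    have h2 : ∃ x, x ∈ Ω ∧ x + T.u ∈ Ω := by
      have aux : ∀ x ∈ Ω, ∀ k : ℤ, 0 < k → x + (k : ℝ) • T.u ∈ Ω → x + T.u ∈ Ω := by
        intro x hx k hk hxk
        have hk' : (1 : ℝ) ≤ k := by exact_mod_cast hk
        have h3 := hconv hx hxk (a := 1 - (k : ℝ)⁻¹) (b := (k : ℝ)⁻¹)
          (sub_nonneg.2 (inv_le_one_of_one_le₀ hk')) (by positivity) (by ring)
        convert h3 using 1
        rw [smul_add, smul_smul, inv_mul_cancel₀ (by positivity), one_smul, ← add_assoc,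
          ← add_smul, sub_add_cancel, one_smul]
      rcases lt_or_gt_of_ne hm with h | h
      · refine ⟨_, h1, aux _ h1 (-m) (by omega) ?_⟩
        simpa using h0
      · exact ⟨_, h0, aux _ h0 m h h1⟩
    obtain ⟨x, hx, hxu⟩ := h2
    -- Moves the midpoint of `x` and `x + u` to the origin, so that the endpoints become `±u / 2`.
    refine hQ (-(x + (2⁻¹ : ℝ) • T.u)) ?_
    rintro _ ⟨k, rfl⟩
    simp only [shift, mem_ofPred_eq, Fin.sum_univ_one, ← hT, sub_neg_eq_add]
    have : k 0 = 0 ∨ k 0 = 1 := by omega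
    rcases this with h | h
    · convert hxu using 1
      rw [h]
      simp only [Fin.val_zero, pow_zero]
      module
    · convert hx using 1
      rw [h]
      simp only [Fin.val_one, pow_one]
      module

/-- Each `freq` annihilates its own direction, so the dual basis consists of the directions of the
opposite family, rescaled; independence makes the scaling factors nonzero. -/
theorem exists_biorthogonal_of_linearIndependent (S T : UniformSet)
    (h : LinearIndependent ℝ ![S.v, T.v]) :
    ∃ E₁ E₂ : Space 2, Biorthogonal S.freq T.freq E₁ E₂ := by
  have aux : ∀ S T : UniformSet, LinearIndependent ℝ ![S.v, T.v] → inner ℝ T.freq S.v ≠ (0 : ℝ) := by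
    intro S T h h0
    obtain ⟨t, ht⟩ := T.exists_eq_add_smul_v S.v
    rw [UniformSet.freq, inner_smul_left, conj_trivial, mul_eq_zero] at h0
    rw [h0.resolve_left (inv_ne_zero T.Δ_pos.ne'), zero_smul, zero_add] at ht
    have := LinearIndependent.pair_iff.1 h 1 (-t) (by rw [ht]; module)
    exact one_ne_zero this.1
  have h1 := aux S T h
  have h2 := aux T S (LinearIndependent.pair_symm_iff.1 h)
  refine ⟨(inner ℝ S.freq T.v : ℝ)⁻¹ • T.v, (inner ℝ T.freq S.v : ℝ)⁻¹ • S.v, ?_, ?_, ?_, ?_⟩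
  · rw [inner_smul_right, inv_mul_cancel₀ h2]
  · rw [inner_smul_right, S.inner_freq_v, mul_zero]
  · rw [inner_smul_right, T.inner_freq_v, mul_zero]
  · rw [inner_smul_right, inv_mul_cancel₀ h1]

theorem nyquistCondition_of_two {Ω : Set (Space 2)} (hΩ : IsCompact Ω) (hconv : Convex ℝ Ω)
    (S : Fin 2 → UniformSet) (hS : LinearIndependent ℝ ![(S 0).v, (S 1).v])
    (hQ : ∀ s : Space 2, ¬ signPoints S ⊆ shift Ω s) :
    NyquistCondition Ω (unionOfUniformSets S) := by
  obtain ⟨E₁, E₂, hb⟩ := exists_biorthogonal_of_linearIndependent _ _ hS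
  set U₁ := (S 0).freq with hU₁
  set U₂ := (S 1).freq with hU₂
  -- The intersection of the two lines of index zero; taken as origin, it absorbs both offsets.
  obtain ⟨x₀, hx₁, hx₂⟩ : ∃ x₀ : Space 2, inner ℝ U₁ (x₀ - (S 0).w) = (0 : ℝ) ∧
      inner ℝ U₂ (x₀ - (S 1).w) = (0 : ℝ) := by
    refine ⟨(inner ℝ U₁ (S 0).w : ℝ) • E₁ + (inner ℝ U₂ (S 1).w : ℝ) • E₂, ?_, ?_⟩
    · simp [inner_sub_right, inner_add_right, inner_smul_right, hb.one_one, hb.one_two]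
    · simp [inner_sub_right, inner_add_right, inner_smul_right, hb.two_one, hb.two_two]
  obtain ⟨n₁, hn₁⟩ := exists_nat_bound_inner (isCompact_scaled hΩ).isBounded E₁
  obtain ⟨n₂, hn₂⟩ := exists_nat_bound_inner (isCompact_scaled hΩ).isBounded E₂
  set n := n₁ + n₂ + 1 with hndef
  have hn : 0 < n := Nat.succ_pos _
  have hn' : (n : ℝ) ≠ 0 := by exact_mod_cast hn.ne'
  have hnK₁ : ∀ x ∈ {ξ : Space 2 | (2 * Real.pi) • ξ ∈ Ω},
      ∀ y ∈ {ξ : Space 2 | (2 * Real.pi) • ξ ∈ Ω}, |inner ℝ (y - x) E₁| < (n : ℝ) :=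
    fun x hx y hy => (hn₁ x hx y hy).trans (by exact_mod_cast (by omega : n₁ < n))
  have hnK₂ : ∀ x ∈ {ξ : Space 2 | (2 * Real.pi) • ξ ∈ Ω},
      ∀ y ∈ {ξ : Space 2 | (2 * Real.pi) • ξ ∈ Ω}, |inner ℝ (y - x) E₂| < (n : ℝ) :=
    fun x hx y hy => (hn₂ x hx y hy).trans (by exact_mod_cast (by omega : n₂ < n))
  let pt : ℤ × ℤ → Space 2 := fun z => x₀ + ((z.1 : ℝ) / n) • E₁ + ((z.2 : ℝ) / n) • E₂
  -- The points of the `1 / n` grid that lie on a line of either family.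
  refine ⟨pt '' {z | (n : ℤ) ∣ z.1 ∨ (n : ℤ) ∣ z.2}, ?_, ?_,
    fun f hf f' hf' h => eq_of_forall_fourierInv hΩ ?_ hf hf' h⟩
  · rintro _ ⟨z, ⟨k, hk⟩ | ⟨k, hk⟩, rfl⟩
    · refine (mem_points_unionOfUniformSets S _).2 ⟨0, k, ?_⟩
      have : pt z - (S 0).w = (x₀ - (S 0).w) + ((z.1 : ℝ) / n) • E₁ + ((z.2 : ℝ) / n) • E₂ := by
        simp only [pt]; abel
      rw [this, inner_add_right, inner_add_right, inner_smul_right, inner_smul_right, ← hU₁, hx₁,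
        hb.one_one, hb.one_two, hk]
      push_cast; field_simp; ring
    · refine (mem_points_unionOfUniformSets S _).2 ⟨1, k, ?_⟩
      have : pt z - (S 1).w = (x₀ - (S 1).w) + ((z.1 : ℝ) / n) • E₁ + ((z.2 : ℝ) / n) • E₂ := by
        simp only [pt]; abel
      rw [this, inner_add_right, inner_add_right, inner_smul_right, inner_smul_right, ← hU₂, hx₂,
        hb.two_one, hb.two_two, hk]
      push_cast; field_simp; ring
  · obtain ⟨r, hr, h⟩ := hb.uniformlyDiscrete x₀ hn
    exact ⟨r, hr, fun x hx y hy => h x (image_subset_range _ _ hx) y (image_subset_range _ _ hy)⟩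
  · intro g hgm hg hgΩ hz
    have hrow := hb.ae_exists_ne_zero hn hnK₂ hgm hg hgΩ x₀ fun j k =>
      hz _ ⟨(n * j, k), Or.inl (dvd_mul_right _ _), by simp [pt, hn']⟩
    have hcol := hb.swap.ae_exists_ne_zero hn hnK₁ hgm hg hgΩ x₀ fun j k =>
      hz _ ⟨(k, n * j), Or.inr (dvd_mul_right _ _), by simp [pt, hn', add_right_comm]⟩
    -- The lattice is countable, so almost every `ξ` satisfies the row and column conditions at all
    -- points of its coset at once.
    have hall : ∀ᵐ ξ : Space 2, ∀ z : ℤ × ℤ,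
        (g (ξ + ((z.1 : ℝ) • U₁ + (z.2 : ℝ) • U₂)) ≠ 0 → ∃ m : ℤ, m ≠ 0 ∧
          g (ξ + ((z.1 : ℝ) • U₁ + (z.2 : ℝ) • U₂) + (m : ℝ) • U₁) ≠ 0) ∧
        (g (ξ + ((z.1 : ℝ) • U₁ + (z.2 : ℝ) • U₂)) ≠ 0 → ∃ m : ℤ, m ≠ 0 ∧
          g (ξ + ((z.1 : ℝ) • U₁ + (z.2 : ℝ) • U₂) + (m : ℝ) • U₂) ≠ 0) := by
      refine ae_all_iff.2 fun z => ?_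
      exact (measurePreserving_add_right volume _).quasiMeasurePreserving.ae (hrow.and hcol)
    filter_upwards [hall] with ξ hξ
    by_contra hne
    set F : ℤ × ℤ → Space 2 := fun z => ξ + ((z.1 : ℝ) • U₁ + (z.2 : ℝ) • U₂) with hF
    have hsupp : ∀ η, g η ≠ 0 → (2 * Real.pi) • η ∈ Ω := fun η h =>
      not_not.1 fun h' => h (hgΩ _ h')
    -- The band in the coordinates of `(U₁, U₂)` around `ξ`; a unit square there is a parallelogram
    -- with sides `u₁`, `u₂` in `Ω`.
    let C : Set (ℝ × ℝ) := {c | (2 * Real.pi) • (ξ + (c.1 • U₁ + c.2 • U₂)) ∈ Ω}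
    have hC : Convex ℝ C := by
      intro c hc c' hc' a b ha hb' hab
      have := hconv hc hc' ha hb' hab
      change _ ∈ Ω
      convert this using 1
      rw [show ξ = (a + b) • ξ by rw [hab, one_smul]]
      simp only [Prod.fst_add, Prod.snd_add, Prod.smul_fst, Prod.smul_snd, smul_eq_mul, hab]
      have hb1 : b = 1 - a := by linarith
      subst hb1
      module
    have hfin : {z : ℤ × ℤ | g (F z) ≠ 0}.Finite := by
      refine ((finite_Icc (-(n : ℤ)) n).prod (finite_Icc (-(n : ℤ)) n)).subset fun z hz' => ?_
      have h1 := hnK₁ ξ (hsupp ξ hne) _ (hsupp _ hz')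
      have h2 := hnK₂ ξ (hsupp ξ hne) _ (hsupp _ hz')
      simp only [hF, add_sub_cancel_left, inner_add_left, inner_smul_left, hb.one_one, hb.one_two,
        hb.two_one, hb.two_two, conj_trivial, mul_zero, mul_one, add_zero, zero_add] at h1 h2
      have h1' : |z.1| < (n : ℤ) := by exact_mod_cast h1
      have h2' : |z.2| < (n : ℤ) := by exact_mod_cast h2
      exact ⟨abs_le.1 h1'.le, abs_le.1 h2'.le⟩
    obtain ⟨p, hp⟩ := exists_unit_square_of_lattice_points hC hfin
      ⟨(0, 0), by simpa [hF] using hne⟩ (fun z hz' => hsupp _ hz')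
      (fun z hz' => by
        obtain ⟨m, hm, hm'⟩ := (hξ z).1 hz'
        have e : F (z.1 + m, z.2) = ξ + ((z.1 : ℝ) • U₁ + (z.2 : ℝ) • U₂) + (m : ℝ) • U₁ := by
          simp only [hF]; push_cast; module
        exact ⟨(z.1 + m, z.2), by rwa [← e] at hm', rfl, by simpa using hm⟩)
      (fun z hz' => by
        obtain ⟨m, hm, hm'⟩ := (hξ z).2 hz'
        have e : F (z.1, z.2 + m) = ξ + ((z.1 : ℝ) • U₁ + (z.2 : ℝ) • U₂) + (m : ℝ) • U₂ := by
          simp only [hF]; push_cast; module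
        exact ⟨(z.1, z.2 + m), by rwa [← e] at hm', rfl, by simpa using hm⟩)
    refine hQ (-((2 * Real.pi) • (ξ + (p.1 • U₁ + p.2 • U₂)) + (2⁻¹ : ℝ) • (S 0).u
      + (2⁻¹ : ℝ) • (S 1).u)) ?_
    rintro _ ⟨k, rfl⟩
    simp only [shift, mem_ofPred_eq, Fin.sum_univ_two, sub_neg_eq_add]
    -- Measured from the centre of the square, its corners are at half-integer coordinates `±1 / 2`.
    have hbool : ∀ a : Fin 2, ∃ b : Bool, (-1 : ℝ) ^ (a : ℕ) = 2 * cond b 1 0 - 1 := by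
      intro a
      fin_cases a
      · exact ⟨true, by norm_num⟩
      · exact ⟨false, by norm_num⟩
    obtain ⟨b₀, hb₀⟩ := hbool (k 0)
    obtain ⟨b₁, hb₁⟩ := hbool (k 1)
    have := hp (b₀, b₁)
    change (2 * Real.pi) • (ξ + ((p.1 + cond b₀ 1 0) • U₁ + (p.2 + cond b₁ 1 0) • U₂)) ∈ Ω at this
    convert this using 1
    rw [hb₀, hb₁, UniformSet.u_eq, UniformSet.u_eq, ← hU₁, ← hU₂]
    module

/-! ### A nonzero field vanishing on all lines -/

theorem fourierInv_compSubConstCLM {d : ℕ} (φ : SchwartzMap (Space d) ℂ) (b r : Space d) :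
    (𝓕⁻ (SchwartzMap.compSubConstCLM ℂ b φ) : SchwartzMap (Space d) ℂ) r =
      Complex.exp (2 * Real.pi * Complex.I * (inner ℝ b r : ℝ)) *
        (𝓕⁻ φ : SchwartzMap (Space d) ℂ) r := by
  simp only [SchwartzMap.fourierInv_coe, Real.fourierInv_eq]
  rw [← integral_const_mul,
    ← integral_add_right_eq_self (fun v => Real.fourierChar (inner ℝ v r) • _) b]
  refine integral_congr_ae (ae_of_all _ fun v => ?_)
  simp only [SchwartzMap.compSubConstCLM_apply, add_sub_cancel_right, inner_add_left,
    AddChar.map_add_eq_mul, Circle.smul_def, Circle.coe_mul, Real.fourierChar_apply, smul_eq_mul]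
  push_cast
  ring_nf

theorem fourierInv_mem_bandlimited {d : ℕ} {Ω : Set (Space d)} (G : SchwartzMap (Space d) ℂ)
    (hG : ∀ ξ, G ξ ≠ 0 → (2 * Real.pi) • ξ ∈ Ω) :
    ((𝓕⁻ G : SchwartzMap (Space d) ℂ) : Space d → ℂ) ∈ bandlimited Ω := by
  refine ⟨(𝓕⁻ G).continuous, (𝓕⁻ G).memLp 2, ?_⟩
  have e : (𝓕 (((𝓕⁻ G).memLp 2).toLp ((𝓕⁻ G : SchwartzMap (Space d) ℂ) : Space d → ℂ)) :
      Lp ℂ 2 (volume : Measure (Space d)))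
      = G.toLp 2 := by
    change 𝓕 ((𝓕⁻ G).toLp 2) = G.toLp 2
    rw [SchwartzMap.toLp_fourier_eq, FourierTransform.fourier_fourierInv_eq]
  have hpi : (2 * Real.pi) ≠ 0 := by positivity
  have hae : ∀ᵐ ξ ∂(volume : Measure (Space d)), G.toLp 2 volume ξ = G ξ :=
    G.coeFn_toLp 2 volume
  filter_upwards [(quasiMeasurePreserving_const_smul (inv_ne_zero hpi)).ae hae]
    with ω hω hωΩ
  rw [fourierL2, e, hω]
  by_contra h
  have := hG _ h
  rw [smul_smul, mul_inv_cancel₀ hpi, one_smul] at this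
  exact hωΩ this

/-- The complement of a countable set of reals is dense, and preimages of dense sets under an open
map are dense. -/
theorem dense_sin_inner_ne_zero {d : ℕ} {ν : Space d} (hν : ν ≠ 0) (w : Space d) :
    Dense {r : Space d | Real.sin (Real.pi * inner ℝ ν (r - w)) ≠ 0} := by
  have hcount : {x : ℝ | Real.sin (Real.pi * (x - inner ℝ ν w)) = 0}.Countable := by
    refine (countable_range fun n : ℤ => (n : ℝ) + inner ℝ ν w).mono fun x hx => ?_
    obtain ⟨n, hn⟩ := Real.sin_eq_zero_iff.1 hx
    refine ⟨n, ?_⟩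
    have := mul_left_cancel₀ Real.pi_ne_zero ((mul_comm _ _).trans hn)
    simp only; linarith
  have hopen : IsOpenMap (innerSL ℝ ν) := by
    refine ContinuousLinearMap.isOpenMap_of_ne_zero _ fun h => hν ?_
    have := congrArg (fun T => T ν) h
    simpa using this
  have := (hcount.dense_compl ℝ).preimage hopen
  convert this using 1
  ext r
  simp [inner_sub_right]

theorem exists_schwartz_small_support {d : ℕ} {δ : ℝ} (hδ : 0 < δ) :
    ∃ φ : SchwartzMap (Space d) ℂ, (∀ ξ, φ ξ ≠ 0 → ‖ξ‖ < δ) ∧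
      (𝓕⁻ φ : SchwartzMap (Space d) ℂ) 0 ≠ 0 := by
  let ψ : ContDiffBump (0 : Space d) := ⟨δ / 2, δ, by positivity, by linarith⟩
  have hψ : ContDiff ℝ ((⊤ : ℕ∞) : WithTop ℕ∞) (fun x => (ψ x : ℂ)) :=
    Complex.ofRealCLM.contDiff.comp ψ.contDiff
  have hψc : HasCompactSupport (fun x => (ψ x : ℂ)) :=
    ψ.hasCompactSupport.comp_left (g := Complex.ofReal) rfl
  have hval : ∀ x, hψc.toSchwartzMap hψ x = (ψ x : ℂ) := fun x => rfl
  refine ⟨hψc.toSchwartzMap hψ, fun ξ hξ => ?_, ?_⟩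
  · rw [hval, Complex.ofReal_ne_zero] at hξ
    have : ξ ∈ Function.support ψ := hξ
    rw [ψ.support_eq, mem_ball_zero_iff] at this
    exact this
  · rw [SchwartzMap.fourierInv_coe, Real.fourierInv_eq]
    simp only [hval, inner_zero_right, AddChar.map_zero_eq_one, one_smul]
    rw [integral_complex_ofReal, Complex.ofReal_ne_zero]
    exact ψ.integral_pos.ne'

namespace UniformSet

variable (S : UniformSet)

theorem freq_ne_zero : S.freq ≠ 0 := fun h => by
  have := S.inner_freq_vperp
  rw [h, inner_zero_left] at this
  exact zero_ne_one this

end UniformSet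

/-- If all sign points of the uniform sets lie in the interior of a translate of `Ω`, then a
nonzero field bandlimited to `Ω` vanishes on all lines. -/
theorem exists_bandlimited_vanishing {N : ℕ} (S : Fin N → UniformSet) {Ω : Set (Space 2)}
    {s : Space 2} (hs : signPoints S ⊆ shift (interior Ω) s) :
    ∃ f ∈ bandlimited Ω, f ≠ 0 ∧ ∀ y ∈ (unionOfUniformSets S).points, f y = 0 := by
  have hpi : (2 * Real.pi) ≠ 0 := by positivity
  let q : (Fin N → Fin 2) → Space 2 := fun k =>
    ∑ i, ((-1 : ℝ) ^ (k i : ℕ)) • ((2⁻¹ : ℝ) • (S i).u)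
  let b : (Fin N → Fin 2) → Space 2 := fun k => (2 * Real.pi)⁻¹ • (q k - s)
  have hb : ∀ k, (2 * Real.pi) • b k ∈ interior Ω := fun k => by
    simp only [b, smul_smul, mul_inv_cancel₀ hpi, one_smul]
    exact hs ⟨k, rfl⟩
  -- There are finitely many sign choices, so one radius works for all of them.
  obtain ⟨δ, hδ, hδΩ⟩ : ∃ δ > 0, ∀ ξ : Space 2, ‖ξ‖ < δ → ∀ k, (2 * Real.pi) • (ξ + b k) ∈ Ω := by
    have h : ∀ᶠ ξ : Space 2 in nhds 0, ∀ k, (2 * Real.pi) • (ξ + b k) ∈ Ω := by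
      refine eventually_all.2 fun k => ?_
      have hc : Continuous fun ξ : Space 2 => (2 * Real.pi) • (ξ + b k) := by fun_prop
      have := hc.continuousAt.preimage_mem_nhds (x := 0)
        (isOpen_interior.mem_nhds (by simpa using hb k))
      filter_upwards [this] with ξ hξ
      exact interior_subset hξ
    obtain ⟨δ, hδ, h⟩ := Metric.eventually_nhds_iff.1 h
    exact ⟨δ, hδ, fun ξ hξ => h (by simpa using hξ)⟩
  obtain ⟨φ, hφ, hφ0⟩ := exists_schwartz_small_support (d := 2) hδ
  -- The two exponentials in `2 i sin`, the index selecting the sign. Their values at the origin,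
  -- multiplied in `c`, carry the signs and the phases of the offsets `w`.
  let e : Fin N → Fin 2 → Space 2 → ℂ := fun i j r => (-1) ^ (j : ℕ) *
    Complex.exp ((-1) ^ (j : ℕ) * (Real.pi * inner ℝ (S i).freq (r - (S i).w) : ℝ) * Complex.I)
  let c : (Fin N → Fin 2) → ℂ := fun k => ∏ i, e i (k i) 0
  let G : SchwartzMap (Space 2) ℂ := ∑ k, c k • SchwartzMap.compSubConstCLM ℂ (b k) φ
  have hGsum : ∀ ξ, G ξ = ∑ k, c k * φ (ξ - b k) := fun ξ => by
    simp [G, SchwartzMap.compSubConstCLM_apply]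
  have hfprod : ∀ r, (𝓕⁻ G : SchwartzMap (Space 2) ℂ) r =
      Complex.exp (-(inner ℝ s r : ℝ) * Complex.I) *
      (∏ i, (2 * Complex.I * (Real.sin (Real.pi * inner ℝ (S i).freq (r - (S i).w)) : ℝ))) *
        (𝓕⁻ φ : SchwartzMap (Space 2) ℂ) r := by
    intro r
    have h1 : (𝓕⁻ G : SchwartzMap (Space 2) ℂ) =
        ∑ k, c k • 𝓕⁻ (SchwartzMap.compSubConstCLM ℂ (b k) φ) := by
      change FourierTransform.fourierInvCLM ℂ (SchwartzMap (Space 2) ℂ) G = _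
      simp only [G, map_sum, map_smul]
      rfl
    have h2 : ∀ i, (2 * Complex.I *
        (Real.sin (Real.pi * inner ℝ (S i).freq (r - (S i).w)) : ℝ)) = ∑ j, e i j r := by
      intro i
      simp only [e, Fin.sum_univ_two, Fin.val_zero, Fin.val_one, pow_zero, pow_one,
        Complex.ofReal_sin, Complex.sin, one_mul, neg_one_mul]
      linear_combination (Complex.exp (-(Real.pi * inner ℝ (S i).freq (r - (S i).w) : ℝ)
        * Complex.I) - Complex.exp ((Real.pi * inner ℝ (S i).freq (r - (S i).w) : ℝ)
        * Complex.I)) * Complex.I_sq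
    have h3 : ∀ k, c k * Complex.exp (2 * Real.pi * Complex.I * (inner ℝ (b k) r : ℝ)) =
        Complex.exp (-(inner ℝ s r : ℝ) * Complex.I) * ∏ i, e i (k i) r := by
      intro k
      simp only [c, e, Finset.prod_mul_distrib, ← Complex.exp_sum]
      rw [mul_assoc, ← Complex.exp_add,
        mul_left_comm (Complex.exp (-(inner ℝ s r : ℝ) * Complex.I)), ← Complex.exp_add]
      congr 2
      simp only [b, q, inner_smul_left, inner_sub_left, sum_inner, UniformSet.u_eq,
        inner_sub_right, inner_zero_right, conj_trivial]
      push_cast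
      have : (Real.pi : ℂ) ≠ 0 := by exact_mod_cast Real.pi_ne_zero
      rw [mul_sub, mul_sub, Finset.mul_sum, Finset.mul_sum, ← add_sub_assoc,
        ← Finset.sum_add_distrib]
      rw [sub_eq_iff_eq_add]
      have h4 : -(inner ℝ s r : ℂ) * Complex.I +
        2 * Real.pi * Complex.I * ((2 * (Real.pi : ℂ))⁻¹ * (inner ℝ s r : ℂ)) = 0 := by
          field_simp; ring
      rw [add_right_comm, h4, zero_add]
      refine Finset.sum_congr rfl fun i _ => ?_
      field_simp
      ring
    rw [h1, sum_apply]
    simp only [smul_apply, fourierInv_compSubConstCLM, smul_eq_mul, ← mul_assoc, h3]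
    rw [← Finset.sum_mul, ← Finset.mul_sum]
    simp only [h2]
    rw [Finset.prod_univ_sum, Fintype.piFinset_univ]
  refine ⟨(𝓕⁻ G : SchwartzMap (Space 2) ℂ), fourierInv_mem_bandlimited G fun ξ hξ => ?_,
    fun h0 => ?_, fun y hy => ?_⟩
  · rw [hGsum] at hξ
    obtain ⟨k, -, hk⟩ := Finset.exists_ne_zero_of_sum_ne_zero hξ
    have := hδΩ _ (hφ _ (right_ne_zero_of_mul hk)) k
    rwa [sub_add_cancel] at this
  -- Off a meagre zero set every sine is nonzero, while the small-band factor is nonzero on a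
  -- neighbourhood of the origin.
  · have hd : Dense (⋂ i, {r : Space 2 |
        Real.sin (Real.pi * inner ℝ (S i).freq (r - (S i).w)) ≠ 0}) :=
      dense_iInter_of_isOpen (fun i => isOpen_ne_fun (by fun_prop) continuous_const)
        fun i => dense_sin_inner_ne_zero (S i).freq_ne_zero _
    obtain ⟨r, hr, hr'⟩ := hd.inter_open_nonempty
      {r | (𝓕⁻ φ : SchwartzMap (Space 2) ℂ) r ≠ 0}
      (isOpen_ne_fun (𝓕⁻ φ).continuous continuous_const) ⟨0, hφ0⟩
    have := congrFun h0 r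
    rw [hfprod, Pi.zero_apply, mul_eq_zero, mul_eq_zero, Finset.prod_eq_zero_iff] at this
    rcases this with (h | ⟨i, -, h⟩) | h
    · exact Complex.exp_ne_zero _ h
    · have h5 := mem_iInter.1 hr' i
      simp only [mul_eq_zero, OfNat.ofNat_ne_zero, Complex.I_ne_zero, or_self, false_or,
        Complex.ofReal_eq_zero] at h
      exact h5 h
    · exact hr h
  · obtain ⟨i, j, hij⟩ := (mem_points_unionOfUniformSets S y).1 hy
    rw [hfprod, Finset.prod_eq_zero (Finset.mem_univ i), mul_zero, zero_mul]
    rw [hij, mul_comm Real.pi, Real.sin_int_mul_pi]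
    simp

/-! ### Concatenation of curves -/

/-- Some continuous curve of length at most `ℓ` from `p` to `q` covers `K`. -/
def CoveredByCurve {d : ℕ} (K : Set (Space d)) (p q : Space d) (ℓ : ℝ≥0∞) : Prop :=
  ∃ γ : ℝ → Space d, ContinuousOn γ (Icc 0 1) ∧ γ 0 = p ∧ γ 1 = q ∧ K ⊆ γ '' Icc 0 1 ∧
    eVariationOn γ (Icc 0 1) ≤ ℓ

namespace CoveredByCurve

variable {d : ℕ} {K K' : Set (Space d)} {p q r : Space d} {ℓ ℓ' : ℝ≥0∞}

theorem mono (h : CoveredByCurve K p q ℓ) (hK : K' ⊆ K) (hℓ : ℓ ≤ ℓ') :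
    CoveredByCurve K' p q ℓ' := by
  obtain ⟨γ, hc, h0, h1, hγ, hv⟩ := h
  exact ⟨γ, hc, h0, h1, hK.trans hγ, hv.trans hℓ⟩

theorem segment (p q : Space d) :
    CoveredByCurve (segment ℝ p q) p q (ENNReal.ofReal (dist p q)) := by
  refine ⟨AffineMap.lineMap p q, AffineMap.lineMap_continuous.continuousOn, by simp, by simp,
    (segment_eq_image_lineMap ℝ p q).subset, ?_⟩
  have hl : LipschitzOnWith (nndist p q) (AffineMap.lineMap p q : ℝ → Space d) (Icc 0 1) :=
    (lipschitzWith_lineMap p q).lipschitzOnWith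
  refine (hl.comp_eVariationOn_le (g := id) (mapsTo_id _)).trans ?_
  have h1 := MonotoneOn.eVariationOn_eq (f := (id : ℝ → ℝ)) (s := Icc 0 1) (a := 0) (b := 1)
    monotoneOn_id (by simp) (by simp)
  rw [inter_self] at h1
  calc (nndist p q : ℝ≥0∞) * eVariationOn id (Icc (0 : ℝ) 1)
      ≤ nndist p q * ENNReal.ofReal (id 1 - id 0) := by rw [h1]
    _ = ENNReal.ofReal (dist p q) := by
      simp [← coe_nndist]

theorem trans (h : CoveredByCurve K p q ℓ) (h' : CoveredByCurve K' q r ℓ') :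
    CoveredByCurve (K ∪ K') p r (ℓ + ℓ') := by
  obtain ⟨γ, hc, h0, h1, hK, hv⟩ := h
  obtain ⟨γ', hc', h0', h1', hK', hv'⟩ := h'
  let η : ℝ → Space d := fun t => if t ≤ 1 / 2 then γ (2 * t) else γ' (2 * t - 1)
  have e1 : EqOn η (γ ∘ fun t => 2 * t) (Icc 0 (1 / 2)) := fun t ht => if_pos ht.2
  have e2 : EqOn η (γ' ∘ fun t => 2 * t - 1) (Icc (1 / 2) 1) := by
    intro t ht
    rcases ht.1.eq_or_lt with h | h
    · rw [← h]
      simp [η, h1, h0']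
    · exact if_neg (not_le.2 h)
  have m1 : MapsTo (fun t : ℝ => 2 * t) (Icc 0 (1 / 2)) (Icc 0 1) := fun t ht =>
    ⟨by linarith [ht.1], by linarith [ht.2]⟩
  have m2 : MapsTo (fun t : ℝ => 2 * t - 1) (Icc (1 / 2) 1) (Icc 0 1) := fun t ht =>
    ⟨by linarith [ht.1], by linarith [ht.2]⟩
  have hu : Icc (0 : ℝ) (1 / 2) ∪ Icc (1 / 2) 1 = Icc 0 1 :=
    Icc_union_Icc_eq_Icc (by norm_num) (by norm_num)
  refine ⟨η, ?_, ?_, ?_, ?_, ?_⟩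
  · rw [← hu]
    refine ContinuousOn.union_of_isClosed ?_ ?_ isClosed_Icc isClosed_Icc
    · exact (hc.comp (by fun_prop) m1).congr e1
    · exact (hc'.comp (by fun_prop) m2).congr e2
  · rw [e1 ⟨le_rfl, by norm_num⟩]
    simp [h0]
  · rw [e2 ⟨by norm_num, le_rfl⟩]
    simp only [Function.comp]
    norm_num [h1']
  · rintro x (hx | hx)
    · obtain ⟨t, ht, rfl⟩ := hK hx
      have ht' : t / 2 ∈ Icc (0 : ℝ) (1 / 2) := ⟨by linarith [ht.1], by linarith [ht.2]⟩
      refine ⟨t / 2, hu ▸ Or.inl ht', ?_⟩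
      rw [e1 ht']
      simp only [Function.comp]
      congr 1; ring
    · obtain ⟨t, ht, rfl⟩ := hK' hx
      have ht' : (t + 1) / 2 ∈ Icc (1 / 2 : ℝ) 1 := ⟨by linarith [ht.1], by linarith [ht.2]⟩
      refine ⟨(t + 1) / 2, hu ▸ Or.inr ht', ?_⟩
      rw [e2 ht']
      simp only [Function.comp]
      congr 1; ring
  · have h := eVariationOn.Icc_add_Icc η (s := univ) (a := 0) (b := 1 / 2) (c := 1)
      (by norm_num) (by norm_num) (mem_univ _)
    simp only [univ_inter] at h
    rw [← h, eVariationOn.eq_of_eqOn e1, eVariationOn.eq_of_eqOn e2]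
    refine add_le_add ((eVariationOn.comp_le_of_monotoneOn γ _ ?_ m1).trans hv)
      ((eVariationOn.comp_le_of_monotoneOn γ' _ ?_ m2).trans hv')
    · intro s _ t _ hst; simp only; linarith
    · intro s _ t _ hst; simp only; linarith

theorem chain {K : ℕ → Set (Space d)} {p : ℕ → Space d} {ℓ : ℕ → ℝ≥0∞} (n : ℕ)
    (h : ∀ k < n, CoveredByCurve (K k) (p k) (p (k + 1)) (ℓ k)) :
    CoveredByCurve (⋃ k < n, K k) (p 0) (p n) (∑ k ∈ Finset.range n, ℓ k) := by
  induction n with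
  | zero =>
    refine (segment (p 0) (p 0)).mono (by simp) (by simp)
  | succ n ih =>
    rw [Finset.sum_range_succ, biUnion_lt_succ]
    exact (ih fun k hk => h k (hk.trans n.lt_succ_self)).trans (h n n.lt_succ_self)

end CoveredByCurve

/-! ### Sweeping the lines inside a disc -/

/-- Compares neighbouring half-chords. Negative arguments, where the root is zero by default, are
allowed, to cover lines missing the disc. -/
theorem abs_sqrt_sub_sqrt_le (x y : ℝ) : |√x - √y| ≤ √|x - y| := by
  wlog h : y ≤ x generalizing x y
  · rw [abs_sub_comm, abs_sub_comm x y]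
    exact this y x (le_of_not_ge h)
  rw [abs_of_nonneg (sub_nonneg.2 (Real.sqrt_le_sqrt h)), abs_of_nonneg (sub_nonneg.2 h),
    sub_le_iff_le_add]
  rcases le_total y 0 with hy | hy
  · rw [Real.sqrt_eq_zero_of_nonpos hy, add_zero]
    exact Real.sqrt_le_sqrt (by linarith)
  · rw [Real.sqrt_le_left (by positivity), add_sq, Real.sq_sqrt (sub_nonneg.2 h), Real.sq_sqrt hy]
    nlinarith [Real.sqrt_nonneg (x - y), Real.sqrt_nonneg y,
      mul_nonneg (Real.sqrt_nonneg (x - y)) (Real.sqrt_nonneg y)]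

/-- On each piece of a cover the variation is at least `c` times the diameter, hence at least `c`
times the measure of the piece; countable subadditivity finishes. -/
theorem mul_volume_le_arcLengthOn {d : ℕ} {p : ℝ → Space d} {c : ℝ} (hc : 0 < c)
    (hp : ∀ s t, dist (p s) (p t) = c * dist s t) (T : Set ℝ) :
    ENNReal.ofReal c * volume T ≤ arcLengthOn p T := by
  refine le_iInf fun I => le_iInf fun hI => le_iInf fun hT => ?_
  calc ENNReal.ofReal c * volume T ≤ ENNReal.ofReal c * ∑' n, volume (I n) := by
        gcongr
        exact (measure_mono hT).trans (measure_iUnion_le _)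
    _ = ∑' n, ENNReal.ofReal c * volume (I n) := ENNReal.tsum_mul_left.symm
    _ ≤ ∑' n, eVariationOn p (I n) := by
        refine ENNReal.tsum_le_tsum fun n => ?_
        have hc0 : ENNReal.ofReal c ≠ 0 := by simpa using hc
        rw [mul_comm, ← ENNReal.le_div_iff_mul_le (Or.inl hc0) (Or.inl ENNReal.ofReal_ne_top)]
        refine (Real.volume_le_diam _).trans (Metric.ediam_le fun s hs t ht => ?_)
        rw [ENNReal.le_div_iff_mul_le (Or.inl hc0) (Or.inl ENNReal.ofReal_ne_top), mul_comm,
          edist_dist, ← ENNReal.ofReal_mul hc.le, ← hp, ← edist_dist]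
        exact eVariationOn.edist_le _ hs ht

namespace UniformSet

variable (S : UniformSet)

theorem line_apply (j : ℤ) (t : ℝ) :
    S.line j t = S.w + ((j : ℝ) * S.Δ) • S.vperp + t • S.v := rfl

theorem norm_sq_add (α β : ℝ) : ‖α • S.vperp + β • S.v‖ ^ 2 = α ^ 2 + (β * ‖S.v‖) ^ 2 := by
  rw [norm_add_sq_real, norm_smul, norm_smul, inner_smul_left, inner_smul_right, S.inner_vperp,
    S.norm_vperp]
  simp [mul_pow]

theorem norm_add_le (α β : ℝ) : ‖α • S.vperp + β • S.v‖ ≤ |α| + |β| * ‖S.v‖ := by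
  refine (_root_.norm_add_le _ _).trans ?_
  rw [norm_smul, norm_smul, S.norm_vperp, mul_one, Real.norm_eq_abs, Real.norm_eq_abs]

theorem dist_line (j : ℤ) (s t : ℝ) : dist (S.line j s) (S.line j t) = ‖S.v‖ * dist s t := by
  rw [dist_eq_norm, line_apply, line_apply, add_sub_add_left_eq_sub, ← sub_smul, norm_smul,
    Real.dist_eq, Real.norm_eq_abs, mul_comm]

theorem line_mem_segment (j : ℤ) {t t₁ t₂ : ℝ} (h : t ∈ segment ℝ t₁ t₂) :
    S.line j t ∈ segment ℝ (S.line j t₁) (S.line j t₂) := by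
  obtain ⟨a, b, ha, hb, hab, rfl⟩ := h
  refine ⟨a, b, ha, hb, hab, ?_⟩
  obtain rfl : b = 1 - a := by linarith
  simp only [line_apply, smul_eq_mul]
  module

/-- A curve passing through the part of a uniform set inside a ball, line by line in alternating
directions, exceeds the length of that part by `O(a ^ (3 / 2))`. -/
theorem exists_coveredByCurve (x : Space 2) :
    ∃ C : ℝ, 0 ≤ C ∧ ∀ a : ℝ, 1 ≤ a → ∃ p q : Space 2, dist p x ≤ C * a ∧ dist q x ≤ C * a ∧
      CoveredByCurve ((⋃ j, range (S.line j)) ∩ Metric.closedBall x a) p q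
        (∑' j : ℤ, arcLengthOn (S.line j) {t | dist (S.line j t) x ≤ a} +
          ENNReal.ofReal (C * (a * √a))) := by
  have hv : 0 < ‖S.v‖ := norm_pos_iff.2 S.v_ne_zero
  have hΔ := S.Δ_pos
  obtain ⟨t₀, ht₀⟩ := S.exists_eq_add_smul_v (x - S.w)
  set α : ℝ := inner ℝ S.vperp (x - S.w) with hα
  clear_value α
  have hsub : ∀ (j : ℤ) t,
      S.line j t - x = ((j : ℝ) * S.Δ - α) • S.vperp + (t - t₀) • S.v := by
    intro j t
    have : x = S.w + (α • S.vperp + t₀ • S.v) := by rw [← ht₀]; abel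
    rw [line_apply, this]
    module
  -- The visited lines are at distance at most `a + c` from `x`; `A * a` bounds their number, and `B
  -- * √a` a jump between neighbouring chord ends.
  set c : ℝ := 2 * |α| + 2 * S.Δ with hc
  have hα0 := abs_nonneg α
  have hc0 : 0 < c := by positivity
  set A : ℝ := 2 * (1 + |α|) / S.Δ + 3 with hA
  set B : ℝ := S.Δ + √(S.Δ * (2 + 3 * c)) with hB
  have hA0 : 0 ≤ A := by positivity
  have hB0 : 0 ≤ B := by positivity
  refine ⟨A * B + (2 + c), by positivity, fun a ha => ?_⟩
  have ha0 : 0 ≤ a := by linarith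
  have hsa : 1 ≤ √a := Real.one_le_sqrt.2 ha
  let d : ℤ → ℝ := fun j => (j : ℝ) * S.Δ - α
  -- Half the chord on line `j`, and zero if the line misses the disc.
  let s : ℤ → ℝ := fun j => √(a ^ 2 - d j ^ 2)
  have hs0 : ∀ j, 0 ≤ s j := fun j => Real.sqrt_nonneg _
  have hsle : ∀ j, s j ≤ a := fun j => by
    refine Real.sqrt_le_iff.2 ⟨ha0, ?_⟩
    nlinarith [sq_nonneg (d j)]
  have hball : ∀ j t, dist (S.line j t) x ≤ a ↔ d j ^ 2 + ((t - t₀) * ‖S.v‖) ^ 2 ≤ a ^ 2 := by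
    intro j t
    rw [dist_eq_norm, hsub, ← S.norm_sq_add, sq_le_sq₀ (norm_nonneg _) ha0]
  have hchord : ∀ j t, dist (S.line j t) x ≤ a → |t - t₀| ≤ s j / ‖S.v‖ := by
    intro j t h
    rw [hball] at h
    rw [le_div_iff₀ hv, ← abs_of_pos hv, ← abs_mul]
    exact Real.abs_le_sqrt (by linarith)
  have hlen : ∀ j, ENNReal.ofReal (2 * s j) ≤
      arcLengthOn (S.line j) {t | dist (S.line j t) x ≤ a} := by
    intro j
    rcases le_total (a ^ 2 - d j ^ 2) 0 with h | h
    · simp [s, Real.sqrt_eq_zero_of_nonpos h]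
    · refine le_trans ?_ (mul_volume_le_arcLengthOn hv (S.dist_line j) _)
      have hsubset : Icc (t₀ - s j / ‖S.v‖) (t₀ + s j / ‖S.v‖) ⊆
          {t | dist (S.line j t) x ≤ a} := by
        intro t ht
        change dist (S.line j t) x ≤ a
        rw [hball]
        have h1 : |t - t₀| ≤ s j / ‖S.v‖ := abs_le.2 ⟨by linarith [ht.1], by linarith [ht.2]⟩
        rw [le_div_iff₀ hv, ← abs_of_pos hv, ← abs_mul] at h1
        have h2 := sq_le_sq' (abs_le.1 h1).1 (abs_le.1 h1).2
        rw [Real.sq_sqrt h] at h2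
        linarith
      calc ENNReal.ofReal (2 * s j)
          = ENNReal.ofReal ‖S.v‖ * volume (Icc (t₀ - s j / ‖S.v‖) (t₀ + s j / ‖S.v‖)) := by
            rw [Real.volume_Icc, ← ENNReal.ofReal_mul hv.le]
            congr 1
            field_simp; ring
        _ ≤ _ := by gcongr
  have hend : ∀ (j : ℤ) (σ : ℝ), (σ = 1 ∨ σ = -1) → |d j| ≤ a + c →
      dist (S.line j (t₀ + σ * (s j / ‖S.v‖))) x ≤ (A * B + (2 + c)) * a := by
    intro j σ hσ hd
    have hσ' : |σ| = 1 := by rcases hσ with rfl | rfl <;> simp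
    rw [dist_eq_norm, hsub, add_sub_cancel_left]
    refine (S.norm_add_le _ _).trans ?_
    rw [abs_mul, hσ', one_mul, abs_of_nonneg (div_nonneg (hs0 j) hv.le), div_mul_cancel₀ _ hv.ne']
    change |d j| + s j ≤ _
    nlinarith [hsle j, mul_nonneg (mul_nonneg hA0 hB0) ha0]
  have hjump : ∀ (j : ℤ) (σ : ℝ), (σ = 1 ∨ σ = -1) → |d j| ≤ a + c →
      dist (S.line j (t₀ + σ * (s j / ‖S.v‖)))
        (S.line (j + 1) (t₀ + σ * (s (j + 1) / ‖S.v‖))) ≤ B * √a := by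
    intro j σ hσ hd
    have hσ' : |σ| = 1 := by rcases hσ with rfl | rfl <;> simp
    have e : S.line j (t₀ + σ * (s j / ‖S.v‖)) - S.line (j + 1) (t₀ + σ * (s (j + 1) / ‖S.v‖)) =
        (-S.Δ) • S.vperp + (σ * ((s j - s (j + 1)) / ‖S.v‖)) • S.v := by
      simp only [line_apply]
      push_cast
      rw [sub_div]
      module
    rw [dist_eq_norm, e]
    refine (S.norm_add_le _ _).trans ?_
    rw [abs_mul, hσ', one_mul, abs_div, abs_of_pos hv, div_mul_cancel₀ _ hv.ne', abs_neg,
      abs_of_pos hΔ]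
    have h1 : |s j - s (j + 1)| ≤ √(S.Δ * (2 + 3 * c)) * √a := by
      refine (abs_sqrt_sub_sqrt_le _ _).trans ?_
      rw [← Real.sqrt_mul (by positivity)]
      refine Real.sqrt_le_sqrt ?_
      have e2 : a ^ 2 - d j ^ 2 - (a ^ 2 - d (j + 1) ^ 2) = S.Δ * (2 * d j + S.Δ) := by
        simp only [d]; push_cast; ring
      rw [e2, abs_mul, abs_of_pos hΔ]
      have h2 : |2 * d j + S.Δ| ≤ 2 * |d j| + S.Δ := by
        refine (abs_add_le _ _).trans ?_
        rw [abs_mul, abs_of_pos hΔ, abs_two]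
      have h3 : |2 * d j + S.Δ| ≤ (2 + 3 * c) * a := by nlinarith
      calc S.Δ * |2 * d j + S.Δ| ≤ S.Δ * ((2 + 3 * c) * a) := by gcongr
        _ = S.Δ * (2 + 3 * c) * a := by ring
    nlinarith
  set M : ℕ := ⌈(a + |α|) / S.Δ⌉₊ with hM
  have hM1 : (a + |α|) / S.Δ ≤ M := Nat.le_ceil _
  have hM2 : (M : ℝ) < (a + |α|) / S.Δ + 1 := Nat.ceil_lt_add_one (by positivity)
  have hM1' : a + |α| ≤ M * S.Δ := (div_le_iff₀ hΔ).1 hM1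
  have hM2' : (M : ℝ) * S.Δ ≤ a + |α| + S.Δ := by
    have := mul_le_mul_of_nonneg_right hM2.le hΔ.le
    rwa [add_mul, div_mul_cancel₀ _ hΔ.ne', one_mul] at this
  have hd : ∀ k : ℕ, k ≤ 2 * M + 1 → |d ((k : ℤ) - M)| ≤ a + c := by
    intro k hk
    have hk' : (k : ℝ) ≤ 2 * M + 1 := by exact_mod_cast hk
    have h1 : ((((k : ℤ) - M : ℤ) : ℝ)) * S.Δ ≤ (M + 1) * S.Δ := by
      gcongr; push_cast; linarith
    have h2 : -(M * S.Δ) ≤ ((((k : ℤ) - M : ℤ) : ℝ)) * S.Δ := by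
      have : (0 : ℝ) ≤ k * S.Δ := by positivity
      push_cast; linarith
    refine abs_le.2 ⟨?_, ?_⟩
    · simp only [d]; linarith [le_abs_self α]
    · simp only [d]; linarith [neg_abs_le α]
  -- The starting end of chord `k`, alternating sides. The lines `-M` to `M` are swept, and the last
  -- vertex sits on line `M + 1`, which is why the bound in `hd` extends to `2 * M + 1`.
  let P : ℕ → Space 2 := fun k =>
    S.line ((k : ℤ) - M) (t₀ + (-1) ^ k * (s ((k : ℤ) - M) / ‖S.v‖))
  have hstep : ∀ k < 2 * M + 1, CoveredByCurve
      (range (S.line ((k : ℤ) - M)) ∩ Metric.closedBall x a) (P k) (P (k + 1))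
      (arcLengthOn (S.line ((k : ℤ) - M)) {t | dist (S.line ((k : ℤ) - M) t) x ≤ a} +
        ENNReal.ofReal (B * √a)) := by
    intro k hk
    set j : ℤ := (k : ℤ) - M with hj
    have hj1 : ((k + 1 : ℕ) : ℤ) - M = j + 1 := by push_cast; ring
    have h1 := CoveredByCurve.segment (P k) (S.line j (t₀ + (-1) ^ (k + 1) * (s j / ‖S.v‖)))
    have h2 := CoveredByCurve.segment (S.line j (t₀ + (-1) ^ (k + 1) * (s j / ‖S.v‖))) (P (k + 1))
    refine (h1.trans h2).mono (fun y hy => Or.inl ?_) (add_le_add ?_ ?_)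
    · obtain ⟨⟨t, rfl⟩, hy⟩ := hy
      have ht := abs_le.1 (hchord j t hy)
      refine S.line_mem_segment j ?_
      rw [segment_eq_uIcc, mem_uIcc, pow_succ]
      rcases neg_one_pow_eq_or ℝ k with h | h <;> rw [← hj, h]
      · right; constructor <;> linarith
      · left; constructor <;> linarith
    · refine le_trans (ENNReal.ofReal_le_ofReal (le_of_eq ?_)) (hlen j)
      simp only [P]
      rw [S.dist_line, Real.dist_eq, pow_succ]
      have e : t₀ + (-1) ^ k * (s j / ‖S.v‖) - (t₀ + (-1) ^ k * -1 * (s j / ‖S.v‖)) =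
          (-1) ^ k * (2 * s j / ‖S.v‖) := by ring
      rw [e, abs_mul, abs_pow, abs_neg, abs_one, one_pow, one_mul,
        abs_of_nonneg (div_nonneg (mul_nonneg zero_le_two (hs0 j)) hv.le)]
      field_simp
    · refine ENNReal.ofReal_le_ofReal ?_
      simp only [P]
      rw [hj1]
      exact hjump j _ (neg_one_pow_eq_or ℝ _) (hd k hk.le)
  refine ⟨P 0, P (2 * M + 1), hend _ _ (neg_one_pow_eq_or ℝ _) (hd 0 (Nat.zero_le _)),
    hend _ _ (neg_one_pow_eq_or ℝ _) (hd _ le_rfl),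
    (CoveredByCurve.chain (2 * M + 1) hstep).mono ?_ ?_⟩
  · rintro y ⟨hy, hya⟩
    obtain ⟨j, t, rfl⟩ := mem_iUnion.1 hy
    have h1 := (hball j t).1 hya
    have h2 : |d j| ≤ a := abs_le_of_sq_le_sq (by nlinarith [sq_nonneg ((t - t₀) * ‖S.v‖)]) ha0
    have h3 := abs_le.1 h2
    have h4 : -(M : ℝ) ≤ j := by
      refine le_of_mul_le_mul_right ?_ hΔ
      simp only [d] at h3
      linarith [neg_abs_le α]
    have h5 : (j : ℝ) ≤ M := by
      refine le_of_mul_le_mul_right ?_ hΔ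
      simp only [d] at h3
      linarith [le_abs_self α]
    have h4' : -(M : ℤ) ≤ j := by exact_mod_cast h4
    have h5' : j ≤ M := by exact_mod_cast h5
    have hj : ((j + M).toNat : ℤ) - M = j := by omega
    refine mem_iUnion₂.2 ⟨(j + M).toNat, by omega, ?_⟩
    rw [hj]
    exact ⟨⟨t, rfl⟩, hya⟩
  · rw [Finset.sum_add_distrib]
    refine add_le_add ?_ ?_
    · refine (ENNReal.sum_le_tsum _).trans (ENNReal.tsum_comp_le_tsum_of_injective
        (f := fun k : ℕ => (k : ℤ) - M) (fun k l h => ?_)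
        fun j : ℤ => arcLengthOn (S.line j) {t | dist (S.line j t) x ≤ a})
      simpa using h
    · rw [Finset.sum_const, Finset.card_range, nsmul_eq_mul, ← ENNReal.ofReal_natCast,
        ← ENNReal.ofReal_mul (Nat.cast_nonneg _)]
      refine ENNReal.ofReal_le_ofReal ?_
      have hn : ((2 * M + 1 : ℕ) : ℝ) ≤ A * a := by
        have h1 : (a + |α|) / S.Δ ≤ (1 + |α|) / S.Δ * a := by
          rw [div_mul_eq_mul_div]
          gcongr
          nlinarith
        have h2 : A * a = 2 * ((1 + |α|) / S.Δ * a) + 3 * a := by rw [hA]; ring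
        rw [h2]
        push_cast
        linarith
      calc ((2 * M + 1 : ℕ) : ℝ) * (B * √a) ≤ A * a * (B * √a) := by gcongr
        _ = A * B * (a * √a) := by ring
        _ ≤ (A * B + (2 + c)) * (a * √a) := by gcongr; linarith

theorem line_injective : Function.Injective S.line := by
  intro j j' h
  have h1 := (S.mem_range_line_iff j (S.line j 0)).1 ⟨0, rfl⟩
  have h2 := (S.mem_range_line_iff j' (S.line j 0)).1 (h ▸ ⟨0, rfl⟩)
  exact_mod_cast h1.symm.trans h2

end UniformSet

/-- `lengthInBall` sums over a set of maps, so coinciding lines would count once. Here they are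
distinct: increments over unit time recover `v`, which separates the families, and the index
separates lines within a family. -/
theorem sum_tsum_arcLengthOn_le_lengthInBall {N : ℕ} (S : Fin N → UniformSet)
    (hS : ∀ i j, i ≠ j → LinearIndependent ℝ ![(S i).v, (S j).v]) (a : ℝ) (x : Space 2) :
    ∑ i, ∑' j : ℤ, arcLengthOn ((S i).line j) {t | dist ((S i).line j t) x ≤ a} ≤
      (unionOfUniformSets S).lengthInBall a x := by
  let ι : Fin N × ℤ → (unionOfUniformSets S).carrier := fun z =>
    ⟨(S z.1).line z.2, mem_iUnion.2 ⟨z.1, z.2, rfl⟩⟩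
  have hι : Function.Injective ι := by
    rintro ⟨i, j⟩ ⟨i', j'⟩ h
    have h1 : (S i).line j = (S i').line j' := congrArg Subtype.val h
    obtain rfl : i = i' := by
      by_contra hne
      have h2 := congrArg (fun p : C(ℝ, Space 2) => p 1 - p 0) h1
      simp only [UniformSet.line_apply, zero_smul, add_zero, add_sub_cancel_left, one_smul] at h2
      have := LinearIndependent.pair_iff.1 (hS i i' hne) 1 (-1) (by rw [h2]; module)
      exact one_ne_zero this.1
    rw [(S i).line_injective h1]
  rw [← tsum_fintype (L := SummationFilter.unconditional _), ← ENNReal.tsum_prod]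
  exact ENNReal.tsum_comp_le_tsum_of_injective hι fun p : (unionOfUniformSets S).carrier =>
    arcLengthOn (p : C(ℝ, Space 2)) {t | dist ((p : C(ℝ, Space 2)) t) x ≤ a}

theorem isLittleO_mul_sqrt (C : ℝ) :
    (fun a : ℝ => C * (a * √a)) =o[atTop] fun a : ℝ => a ^ 2 := by
  refine IsLittleO.const_mul_left ?_ C
  have h : (fun a : ℝ => √a) =o[atTop] fun a : ℝ => a := by
    refine (isLittleO_iff_tendsto' ?_).2 ?_
    · filter_upwards [eventually_gt_atTop (0 : ℝ)] with a ha h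
      exact absurd h ha.ne'
    · simp_rw [Real.sqrt_div_self', one_div]
      exact tendsto_inv_atTop_zero.comp Real.tendsto_sqrt_atTop
  simpa [sq] using (isBigO_refl (fun a : ℝ => a) atTop).mul_isLittleO h

theorem points_unionOfUniformSets {N : ℕ} (S : Fin N → UniformSet) :
    (unionOfUniformSets S).points = ⋃ i, ⋃ j, range ((S i).line j) := by
  ext y
  simp only [mem_points_unionOfUniformSets, ← UniformSet.mem_range_line_iff, mem_iUnion]

/-- The sweeps of the two families are joined by one segment, whose length is `O(a)` because the
ends of each sweep stay within `O(a)` of `x`. -/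
theorem nonDegenerate_unionOfUniformSets {N : ℕ} (hN : N = 1 ∨ N = 2) (S : Fin N → UniformSet)
    (hS : ∀ i j, i ≠ j → LinearIndependent ℝ ![(S i).v, (S j).v]) :
    NonDegenerate (unionOfUniformSets S) := by
  intro x
  choose C hC0 hC using fun i => (S i).exists_coveredByCurve x
  suffices h : ∃ D : ℝ, ∀ a : ℝ, 1 ≤ a → ∃ p q, CoveredByCurve
      ((unionOfUniformSets S).points ∩ Metric.closedBall x a) p q
      (∑ i, ∑' j : ℤ, arcLengthOn ((S i).line j) {t | dist ((S i).line j t) x ≤ a} +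
        ENNReal.ofReal (D * (a * √a))) by
    obtain ⟨D, hD⟩ := h
    refine ⟨_, isLittleO_mul_sqrt D, ?_⟩
    filter_upwards [eventually_ge_atTop 1] with a ha
    obtain ⟨p, q, γ, hc, -, -, hcov, hlen⟩ := hD a ha
    refine ⟨γ, hc, hcov, hlen.trans ?_⟩
    gcongr
    exact sum_tsum_arcLengthOn_le_lengthInBall S hS a x
  rcases hN with rfl | rfl
  · refine ⟨C 0, fun a ha => ?_⟩
    obtain ⟨p, q, -, -, h⟩ := hC 0 a ha
    refine ⟨p, q, h.mono ?_ (by simp)⟩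
    rw [points_unionOfUniformSets]
    rintro y ⟨hy, hya⟩
    obtain ⟨i, hi⟩ := mem_iUnion.1 hy
    obtain rfl : i = 0 := Subsingleton.elim _ _
    exact ⟨hi, hya⟩
  -- One `C 0 + C 1` pays for the excess of the two sweeps, the other for the joining segment.
  · refine ⟨2 * (C 0 + C 1), fun a ha => ?_⟩
    obtain ⟨p, q, -, hq, h⟩ := hC 0 a ha
    obtain ⟨p', q', hp', -, h'⟩ := hC 1 a ha
    refine ⟨p, q', ((h.trans (CoveredByCurve.segment q p')).trans h').mono ?_ ?_⟩
    · rw [points_unionOfUniformSets]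
      rintro y ⟨hy, hya⟩
      obtain ⟨i, hi⟩ := mem_iUnion.1 hy
      fin_cases i
      · exact Or.inl (Or.inl ⟨hi, hya⟩)
      · exact Or.inr ⟨hi, hya⟩
    · have hsa : 1 ≤ √a := Real.one_le_sqrt.2 ha
      have ha0 : 0 ≤ a := by linarith
      have hd : dist q p' ≤ (C 0 + C 1) * (a * √a) := by
        have h1 := dist_triangle_right q p' x
        have h2 : (C 0 + C 1) * a ≤ (C 0 + C 1) * (a * √a) :=
          mul_le_mul_of_nonneg_left (le_mul_of_one_le_right ha0 hsa)
            (add_nonneg (hC0 0) (hC0 1))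
        linarith
      have haa : 0 ≤ a * √a := by positivity
      have e : 2 * (C 0 + C 1) * (a * √a) =
          C 0 * (a * √a) + (C 0 + C 1) * (a * √a) + C 1 * (a * √a) := by ring
      rw [Fin.sum_univ_two, e, ENNReal.ofReal_add (add_nonneg (mul_nonneg (hC0 0) haa)
          (mul_nonneg (add_nonneg (hC0 0) (hC0 1)) haa)) (mul_nonneg (hC0 1) haa),
        ENNReal.ofReal_add (mul_nonneg (hC0 0) haa)
          (mul_nonneg (add_nonneg (hC0 0) (hC0 1)) haa)]
      set T₀ := ∑' j : ℤ, arcLengthOn ((S 0).line j) {t | dist ((S 0).line j t) x ≤ a}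
      set T₁ := ∑' j : ℤ, arcLengthOn ((S 1).line j) {t | dist ((S 1).line j t) x ≤ a}
      calc T₀ + ENNReal.ofReal (C 0 * (a * √a)) + ENNReal.ofReal (dist q p') +
            (T₁ + ENNReal.ofReal (C 1 * (a * √a)))
          ≤ T₀ + ENNReal.ofReal (C 0 * (a * √a)) + ENNReal.ofReal ((C 0 + C 1) * (a * √a)) +
            (T₁ + ENNReal.ofReal (C 1 * (a * √a))) := by gcongr
        _ = _ := by abel

end

/-! ### The theorem -/

theorem theorem1 (Ω : Set (Space 2)) (hΩ : IsCompact Ω) (hconv : Convex ℝ Ω)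
    (N : ℕ) (hN : N = 1 ∨ N = 2) (S : Fin N → UniformSet)
    (hS : ∀ i j, i ≠ j → LinearIndependent ℝ ![(S i).v, (S j).v]) :
    ((∀ s : Space 2, ¬ signPoints S ⊆ shift Ω s) →
      IsNyquistTrajectorySet Ω (unionOfUniformSets S)) ∧
    ((∃ s : Space 2, signPoints S ⊆ shift (interior Ω) s) →
      ¬ IsNyquistTrajectorySet Ω (unionOfUniformSets S)) := by
  refine ⟨fun hQ => ⟨?_, nonDegenerate_unionOfUniformSets hN S hS⟩, ?_⟩
  · rcases hN with rfl | rfl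
    · exact nyquistCondition_of_one hΩ hconv S hQ
    · exact nyquistCondition_of_two hΩ hconv S (hS 0 1 (by decide)) hQ
  · rintro ⟨s, hs⟩ ⟨⟨L, hL, -, huniq⟩, -⟩
    obtain ⟨f, hf, hf0, hvan⟩ := exists_bandlimited_vanishing S hs
    -- The zero field is bandlimited, and it agrees with `f` on any samples taken from the lines.
    have h0 : f - f ∈ bandlimited Ω := sub_mem_bandlimited hf hf
    refine hf0 (huniq f hf 0 (by rwa [sub_self] at h0) fun x hx => ?_)
    exact hvan x (hL hx)
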